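/- Let $(R,\mathfrak m,k)$ be a Noetherian local domain with infinite residue field $k$ and fraction field $K$. Suppose that $R$ has an $S_2$-ification $S$ which is a regular local ring; here an $S_2$-ification of $R$ is a ring $R\subseteq S\subseteq K$ that is module-finite over $R$, satisfies Serre's condition $S_2$ as an $R$-module (that is, $\operatorname{depth} S_{\mathfrak p}\ge\min(2,\dim S_{\mathfrak p})$ for every prime $\mathfrak p$ of $R$), and is such that the ideal $R:_R s=\{r\in R: rs\in R\}$ has height at least $2$ for every $s\in S\setminus R$. A finitely generated $R$-module $M$ is called MCM (maximal Cohen--Macaulay) if $\operatorname{depth}_R M=\dim R$ (so $M\neq 0$), and an Ulrich module if moreover $e_R(M)=\nu_R(M)$, where $\nu_R(M)$ is the minimal number of generators of $M$ and $e_R(M)=d!\lim_{n\to\infty}\ell_R(M/\mathfrak m^nM)/n^d$, $d=\dim M$, is the multiplicity. A reduction of $\mathfrak m$ is an ideal $I\subseteq\mathfrak m$ with $I\mathfrak m^n=\mathfrak m^{n+1}$ for some $n\ge 0$; a minimal reduction is one that is minimal under inclusion among the reductions of $\mathfrak m$. Then: 1. Every MCM $R$-module is isomorphic, as an $R$-module,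 to $S^{\oplus h}$ for some $h\in\mathbb N$. 2. $R$ has an Ulrich module if and only if $S$ is an Ulrich module of $R$. 3. $S$ is an Ulrich module of $R$ if and only if $IS=\mathfrak mS$ for every minimal reduction $I$ of $\mathfrak m$. Moreover, for each single minimal reduction $I$ of $\mathfrak m$, $S$ is an Ulrich module of $R$ if and only if $IS=\mathfrak mS$. -/

import Mathlib

open Filter Topology IsLocalRing

universe u v w

noncomputable section

/-- The depth of a module `M` over a local ring `R`: the supremum of the lengths of the
`M`-regular sequences in the maximal ideal. If `𝔪M ≠ M`, a weakly regular sequence in `𝔪` is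
regular; the zero module gets depth `⊤`, as usual. -/
def localDepth (R M : Type*) [CommRing R] [IsLocalRing R] [AddCommGroup M] [Module R M] : ℕ∞ :=
  ⨆ (rs : List R) (_ : ∀ r ∈ rs, r ∈ maximalIdeal R)
    (_ : RingTheory.Sequence.IsWeaklyRegular M rs), (rs.length : ℕ∞)

/-- Maximal Cohen-Macaulay modules: finitely generated with `depth M = dim R`.
(Over a Noetherian local ring such a module is nonzero, since `dim R` is finite.) -/
structure IsMCM (R M : Type*) [CommRing R] [IsLocalRing R] [AddCommGroup M] [Module R M] :
    Prop where
  finite : Module.Finite R M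
  depth_eq : (localDepth R M : WithBot ℕ∞) = ringKrullDim R

/-- `e_R(M) = e`, that is, `d! · ℓ(M / 𝔪ⁿM) / nᵈ → e` as `n → ∞`, where `d = dim M`. -/
def HasMultiplicity (R M : Type*) [CommRing R] [IsLocalRing R] [AddCommGroup M] [Module R M]
    (e : ℝ) : Prop :=
  ∃ d : ℕ, Module.supportDim R M = (d : WithBot ℕ∞) ∧
    Tendsto (fun n : ℕ =>
      (d.factorial : ℝ) *
        (Module.length R (M ⧸ (maximalIdeal R ^ n • ⊤ : Submodule R M))).toNat / (n : ℝ) ^ d)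
      atTop (𝓝 e)

/-- Ulrich modules: MCM modules `M` whose multiplicity `e_R(M)` equals the minimal number
`ν_R(M)` of generators. -/
structure IsUlrich (R M : Type*) [CommRing R] [IsLocalRing R] [AddCommGroup M] [Module R M] :
    Prop where
  isMCM : IsMCM R M
  multiplicity_eq : HasMultiplicity R M ((⊤ : Submodule R M).spanFinrank : ℝ)

/-- `I` is a reduction of `J`: `I ⊆ J` and `I Jⁿ = Jⁿ⁺¹` for some `n`. -/
def IsIdealReduction {R : Type*} [CommRing R] (I J : Ideal R) : Prop :=
  I ≤ J ∧ ∃ n : ℕ, I * J ^ n = J ^ (n + 1)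

/-- `I` is a minimal reduction of `J`: it is minimal, under inclusion, among the reductions
of `J`. -/
def IsMinimalReduction {R : Type*} [CommRing R] (I J : Ideal R) : Prop :=
  Minimal (fun I' : Ideal R => IsIdealReduction I' J) I

/-- Serre's condition `S₂` for an `R`-module `M`:
`depth M_p ≥ min(2, dim M_p)` for every prime `p` of `R`. -/
def SatisfiesS2 (R M : Type*) [CommRing R] [AddCommGroup M] [Module R M] : Prop :=
  ∀ (p : Ideal R) [p.IsPrime],
    min 2 (Module.supportDim (Localization.AtPrime p) (LocalizedModule p.primeCompl M)) ≤
      (localDepth (Localization.AtPrime p) (LocalizedModule p.primeCompl M) : WithBot ℕ∞)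

/-- The ideal `R :_R s = {r ∈ R | r s ∈ R}` for an element `s` of an `R`-algebra `K`. -/
def denominatorIdeal (R : Type*) {K : Type*} [CommRing R] [CommRing K] [Algebra R K] (s : K) :
    Ideal R :=
  (1 : Submodule R K).comap (LinearMap.toSpanSingleton R K s)

/-- An `S₂`-ification of a domain `R` with fraction field `K`: a ring `R ⊆ S ⊆ K`, module-finite
over `R`, satisfying `S₂` as an `R`-module, and such that `R :_R s` has height at least two for
every `s ∈ S` not in `R`. -/
structure IsS2ification (R : Type*) {K : Type*} [CommRing R] [Field K] [Algebra R K]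
    (S : Subalgebra R K) : Prop where
  finite : Module.Finite R S
  satisfiesS2 : SatisfiesS2 R S
  two_le_height : ∀ s ∈ S, s ∉ (algebraMap R K).range → 2 ≤ (denominatorIdeal R s).height

end

/-! Let d = dim R and let M be MCM. Depth is at most dim R/P for each associated prime P, so M is
torsion-free and embeds in V = K ⊗ M. For the same reason an ideal J of height at least two contains
x, y with x regular on M and y regular on M/xM. If v ∈ V and Jv ⊆ M, then y(xv) = x(yv) forces xv ∈
xM, hence v ∈ M. With J = R :_R s this gives sM ⊆ M for all s ∈ S, so M is an S-module
(`HasDepthAtLeast.exists_linearEquiv_submodule`). As S is local and finite over R, dim S = d and M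
has depth at least d over S. Generators of the maximal ideal of the regular ring S then form an
M-regular sequence, and freeness lifts from the residue field one generator at a time
(`module_free_of_isWeaklyRegular`).

Since k is infinite, a minimal reduction I of 𝔪 is generated by d elements
(`exists_ofList_isIdealReduction`): superficial elements exist by avoiding finitely many proper
submodules, and one inducts on the dimension. These d elements form a regular sequence on M, so
ℓ(M/Iⁿ⁺¹M) is a binomial coefficient times ℓ(M/IM). The powers of I and 𝔪 agree up to a bounded
shift, so e(M) = ℓ(M/IM), while ν(M) = ℓ(M/𝔪M). As IM ⊆ 𝔪M, M is Ulrich exactly when IM = 𝔪M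
(`HasDepthAtLeast.isUlrich_iff`). This applies to S, which is MCM because it is regular, and the
equality passes from M ≅ S^h with h > 0 to its quotient S.

Depth is handled by explicit regular sequences; `HasDepthAtLeast.quotSMulTop` makes the count
independent of the chosen regular element. -/

open RingTheory.Sequence Pointwise

/-- There is a weakly `M`-regular sequence of length `n` in the maximal ideal. -/
def HasDepthAtLeast (R M : Type*) [CommRing R] [IsLocalRing R] [AddCommGroup M] [Module R M]
    (n : ℕ) : Prop :=
  ∃ rs : List R, rs.length = n ∧ (∀ r ∈ rs, r ∈ maximalIdeal R) ∧ IsWeaklyRegular M rs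

/-! ### Depth and regular sequences over Noetherian local rings -/

section Depth

variable {R M N : Type*} [CommRing R] [AddCommGroup M] [Module R M] [AddCommGroup N] [Module R N]

theorem isSMulRegular_quotSMulTop_iff {x y : R} :
    IsSMulRegular (QuotSMulTop x M) y ↔ ∀ u v : M, y • u = x • v → ∃ w, u = x • w := by
  rw [isSMulRegular_quotient_iff_mem_of_smul_mem]
  simp only [Submodule.mem_smul_pointwise_iff_exists, Submodule.mem_top, true_and]
  constructor
  · intro h u v e
    obtain ⟨w, hw⟩ := h u ⟨v, e.symm⟩
    exact ⟨w, hw.symm⟩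
  · rintro h u ⟨v, hv⟩
    obtain ⟨w, hw⟩ := h u v hv.symm
    exact ⟨w, hw.symm⟩

/-- If no nonzero element of `M` is killed by the ideal `J`, then `J` contains an `M`-regular
element. -/
theorem exists_mem_isSMulRegular [IsNoetherianRing R] [Module.Finite R M] (J : Ideal R)
    (h : ∀ u : M, (∀ r ∈ J, r • u = 0) → u = 0) : ∃ z ∈ J, IsSMulRegular M z := by
  by_contra! hcon
  have hsub : (J : Set R) ⊆ ⋃ p ∈ associatedPrimes R M, p := by
    rw [biUnion_associatedPrimes_eq_compl_regular R M]
    exact fun r hr => hcon r hr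
  obtain ⟨P, hP, hJP⟩ := (Ideal.subset_union_prime_finite (associatedPrimes.finite R M) 0 0
    fun I hI _ _ => IsAssociatedPrime.isPrime hI).mp hsub
  obtain ⟨hprime, u, hu⟩ := isAssociatedPrime_iff.mp hP
  have hu0 : u = 0 := h u fun r hr => by
    have := hJP hr
    simpa [hu, Submodule.mem_colon_singleton] using this
  exact hprime.ne_top (by rw [hu, hu0, Submodule.colon_singleton_zero])

theorem exists_mem_isSMulRegular_of_notMem_associatedPrimes [IsNoetherianRing R]
    [Module.Finite R M] (J : Ideal R) (h : ∀ P ∈ associatedPrimes R M, ¬ J ≤ P) :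
    ∃ z ∈ J, IsSMulRegular M z := by
  by_contra! hcon
  have hsub : (J : Set R) ⊆ ⋃ p ∈ associatedPrimes R M, p := by
    rw [biUnion_associatedPrimes_eq_compl_regular R M]
    exact fun r hr => hcon r hr
  obtain ⟨P, hP, hJP⟩ := (Ideal.subset_union_prime_finite (associatedPrimes.finite R M) 0 0
    fun I hI _ _ => IsAssociatedPrime.isPrime hI).mp hsub
  exact h P hP hJP

theorem IsSMulRegular.eq_zero_of_smul_eq_zero {x : R} (h : IsSMulRegular M x) {u : M}
    (hu : x • u = 0) : u = 0 := h (by simpa using hu)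

/-- Vanishing of the `J`-torsion of `M / aM` does not depend on the `M`-regular element `a ∈ J`. -/
theorem quotSMulTop_torsion_eq_zero {J : Ideal R} {a x : R} (ha : a ∈ J)
    (hra : IsSMulRegular M a) (hrx : IsSMulRegular M x)
    (h : ∀ u : QuotSMulTop a M, (∀ r ∈ J, r • u = 0) → u = 0) :
    ∀ u : QuotSMulTop x M, (∀ r ∈ J, r • u = 0) → u = 0 := by
  intro u hu
  obtain ⟨u, rfl⟩ := Submodule.mkQ_surjective _ u
  have key : ∀ r ∈ J, ∃ v, r • u = x • v := fun r hr => by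
    have := hu r hr
    rw [← map_smul, Submodule.mkQ_apply, Submodule.Quotient.mk_eq_zero,
      Submodule.mem_smul_pointwise_iff_exists] at this
    obtain ⟨v, -, hv⟩ := this
    exact ⟨v, hv.symm⟩
  -- The relation au = xv matches the class of u in M/xM with the class of v in M/aM, and the latter
  -- is again killed by `J`.
  obtain ⟨v, hv⟩ := key a ha
  have hv0 : Submodule.mkQ (a • (⊤ : Submodule R M)) v = 0 := h _ fun r hr => by
    obtain ⟨w, hw⟩ := key r hr
    rw [← map_smul, Submodule.mkQ_apply, Submodule.Quotient.mk_eq_zero,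
      Submodule.mem_smul_pointwise_iff_exists]
    refine ⟨w, trivial, hrx ?_⟩
    change x • a • w = x • r • v
    rw [smul_comm x a, ← hw, smul_comm x r, ← hv, smul_comm]
  rw [Submodule.mkQ_apply, Submodule.Quotient.mk_eq_zero,
      Submodule.mem_smul_pointwise_iff_exists] at hv0 ⊢
  obtain ⟨v', -, rfl⟩ := hv0
  refine ⟨v', trivial, hra ?_⟩
  change a • x • v' = a • u
  rw [hv, smul_comm]

variable [IsLocalRing R]

theorem HasDepthAtLeast.of_le {m n : ℕ} (h : HasDepthAtLeast R M n) (hmn : m ≤ n) :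
    HasDepthAtLeast R M m := by
  obtain ⟨rs, rfl, hm, hr⟩ := h
  refine ⟨rs.take m, by simpa using hmn, fun r hr => hm r (List.mem_of_mem_take hr), ?_⟩
  rw [← List.take_append_drop m rs, isWeaklyRegular_append_iff] at hr
  exact hr.1

theorem natCast_le_localDepth_iff {n : ℕ} :
    (n : ℕ∞) ≤ localDepth R M ↔ HasDepthAtLeast R M n := by
  constructor
  · intro h
    by_contra hcon
    cases n with
    | zero => exact hcon ⟨[], rfl, by simp, .nil R M⟩
    | succ n =>
      have : localDepth R M ≤ n := iSup_le fun rs => iSup_le fun h1 => iSup_le fun h2 => by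
        by_contra! hlt
        exact hcon (HasDepthAtLeast.of_le ⟨rs, rfl, h1, h2⟩
          (Nat.succ_le_of_lt (by exact_mod_cast hlt)))
      have := h.trans this
      norm_cast at this
      omega
  · rintro ⟨rs, rfl, h1, h2⟩
    exact le_iSup_of_le rs (le_iSup_of_le h1 (le_iSup_of_le h2 le_rfl))

theorem hasDepthAtLeast_zero : HasDepthAtLeast R M 0 := ⟨[], rfl, by simp, .nil R M⟩

theorem HasDepthAtLeast.of_linearEquiv {n : ℕ} (h : HasDepthAtLeast R M n) (e : M ≃ₗ[R] N) :
    HasDepthAtLeast R N n := by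
  obtain ⟨rs, h1, h2, h3⟩ := h
  exact ⟨rs, h1, h2, (e.isWeaklyRegular_congr rs).mp h3⟩

theorem hasDepthAtLeast_succ_iff {n : ℕ} : HasDepthAtLeast R M (n + 1) ↔
    ∃ x ∈ maximalIdeal R, IsSMulRegular M x ∧ HasDepthAtLeast R (QuotSMulTop x M) n := by
  constructor
  · rintro ⟨_ | ⟨x, rs⟩, h1, h2, h3⟩
    · simp at h1
    · rw [isWeaklyRegular_cons_iff] at h3
      exact ⟨x, h2 x (by simp), h3.1, rs, by simpa using h1,
        fun r hr => h2 r (by simp [hr]), h3.2⟩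
  · rintro ⟨x, hx, hr, rs, h1, h2, h3⟩
    exact ⟨x :: rs, by simp [h1], by simpa using ⟨hx, h2⟩, .cons hr h3⟩

theorem HasDepthAtLeast.torsion_eq_zero {n : ℕ} (h : HasDepthAtLeast R M (n + 1)) (u : M)
    (hu : ∀ r ∈ maximalIdeal R, r • u = 0) : u = 0 := by
  obtain ⟨x, hx, hr, -⟩ := hasDepthAtLeast_succ_iff.mp h
  exact hr.eq_zero_of_smul_eq_zero (hu x hx)

variable [IsNoetherianRing R]

/-- Dividing by a regular element drops the depth by at most one. -/
theorem HasDepthAtLeast.quotSMulTop {n : ℕ} {M : Type*} [AddCommGroup M] [Module R M]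
    [Module.Finite R M] (h : HasDepthAtLeast R M (n + 1))
    {x : R} (hx : x ∈ maximalIdeal R) (hrx : IsSMulRegular M x) :
    HasDepthAtLeast R (QuotSMulTop x M) n := by
  induction n generalizing M x with
  | zero => exact hasDepthAtLeast_zero
  | succ n ih =>
    obtain ⟨a, ha, hra, hda⟩ := hasDepthAtLeast_succ_iff.mp h
    have tM := h.torsion_eq_zero
    have ta := hda.torsion_eq_zero
    have tx := quotSMulTop_torsion_eq_zero ha hra hrx ta
    -- Regularity on the product yields one z regular on M, M/aM and M/xM simultaneously, which
    -- links a to x.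
    obtain ⟨z, hz, hrz⟩ := exists_mem_isSMulRegular
      (M := M × QuotSMulTop a M × QuotSMulTop x M) (maximalIdeal R) (by
        rintro ⟨u, v, w⟩ huvw
        simp only [Prod.smul_mk, Prod.mk_eq_zero] at huvw ⊢
        exact ⟨tM u fun r hr => (huvw r hr).1, ta v fun r hr => (huvw r hr).2.1,
          tx w fun r hr => (huvw r hr).2.2⟩)
    have rM : IsSMulRegular M z := hrz.of_injective (LinearMap.inl R M _) LinearMap.inl_injective
    have rax := hrz.of_injective (LinearMap.inr R M (QuotSMulTop a M × QuotSMulTop x M))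
      LinearMap.inr_injective
    have ra : IsSMulRegular (QuotSMulTop a M) z :=
      rax.of_injective (LinearMap.inl R _ _) LinearMap.inl_injective
    have rx : IsSMulRegular (QuotSMulTop x M) z :=
      rax.of_injective (LinearMap.inr R _ _) LinearMap.inr_injective
    -- Swapping a, z in the regular sequence a, z, ts bounds the depth of M/zM from below. The
    -- induction hypothesis then applies to M/zM and x, and a second swap brings x to the front.
    obtain ⟨ts, t1, t2, t3⟩ := ih hda hz ra
    have h1 : IsWeaklyRegular M (z :: a :: ts) :=
      isWeaklyRegular_of_perm_of_subset_maximalIdeal (.cons hra (.cons ra t3))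
        (List.Perm.swap z a ts) (by simpa using ⟨ha, hz, t2⟩)
    have hdz : HasDepthAtLeast R (QuotSMulTop z M) (n + 1) :=
      ⟨a :: ts, by simp [t1], by simpa using ⟨ha, t2⟩, ((isWeaklyRegular_cons_iff _ _ _).mp h1).2⟩
    have h2 : IsWeaklyRegular M [z, x] :=
      isWeaklyRegular_of_perm_of_subset_maximalIdeal (.cons hrx (.cons rx (.nil _ _)))
        (List.Perm.swap z x []) (by simpa using ⟨hx, hz⟩)
    have hxz : IsSMulRegular (QuotSMulTop z M) x := by
      rw [isWeaklyRegular_cons_iff, isWeaklyRegular_cons_iff] at h2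
      exact h2.2.1
    obtain ⟨us, u1, u2, u3⟩ := ih hdz hx hxz
    have h3 : IsWeaklyRegular M (x :: z :: us) :=
      isWeaklyRegular_of_perm_of_subset_maximalIdeal (.cons rM (.cons hxz u3))
        (List.Perm.swap x z us) (by simpa using ⟨hz, hx, u2⟩)
    exact ⟨z :: us, by simp [u1], by simpa using ⟨hz, u2⟩,
      ((isWeaklyRegular_cons_iff _ _ _).mp h3).2⟩

/-- If `P` is associated to `M` and `x` is `M`-regular, then some prime associated to `M / xM`
contains `P` and `x`. -/
theorem exists_associatedPrime_quotSMulTop {M : Type*} [AddCommGroup M] [Module R M]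
    [Module.Finite R M] {x : R} (hx : x ∈ maximalIdeal R) (hrx : IsSMulRegular M x)
    {P : Ideal R} (hP : P ∈ associatedPrimes R M) :
    ∃ Q ∈ associatedPrimes R (QuotSMulTop x M), P ≤ Q ∧ x ∈ Q := by
  obtain ⟨hprime, u, hu⟩ := isAssociatedPrime_iff.mp hP
  let T : Submodule R M :=
    { carrier := {m | ∀ r ∈ P, r • m = 0}
      add_mem' := fun ha hb r hr => by rw [smul_add, ha r hr, hb r hr, add_zero]
      zero_mem' := fun r _ => smul_zero r
      smul_mem' := fun c m hm r hr => by rw [smul_comm, hm r hr, smul_zero] }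
  have huT : u ∈ T := fun r hr => by
    simpa [hu, Submodule.mem_colon_singleton] using hr
  have hu0 : u ≠ 0 := fun h => hprime.ne_top (by rw [hu, h, Submodule.colon_singleton_zero])
  -- If the P-torsion T were inside xM, then T = xT because x is regular, and Nakayama would give T
  -- = 0. A t outside xM has a nonzero class in M/xM killed by both P and x.
  obtain ⟨t, ht, htx⟩ : ∃ t ∈ T, t ∉ x • (⊤ : Submodule R M) := by
    by_contra! hcon
    have : T ≤ maximalIdeal R • T := fun t ht => by
      obtain ⟨s, -, rfl⟩ := (Submodule.mem_smul_pointwise_iff_exists _ _ _).mp (hcon t ht)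
      refine Submodule.smul_mem_smul hx fun r hr => hrx.eq_zero_of_smul_eq_zero ?_
      rw [smul_comm]
      exact ht r hr
    have hbot := Submodule.eq_bot_of_le_smul_of_le_jacobson_bot (maximalIdeal R) T
      (IsNoetherian.noetherian T) this (maximalIdeal_le_jacobson _)
    exact hu0 (by simpa [hbot] using huT)
  obtain ⟨Q, hQ, hle⟩ := exists_le_isAssociatedPrime_of_isNoetherianRing R
    (Submodule.mkQ (x • (⊤ : Submodule R M)) t) (by simpa using htx)
  refine ⟨Q, hQ, fun r hr => hle ?_, hle ?_⟩
  · rw [Submodule.mem_colon_singleton, ← map_smul, ht r hr, map_zero]; exact zero_mem _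
  · rw [Submodule.mem_colon_singleton, ← map_smul, Submodule.mem_bot, Submodule.mkQ_apply,
      Submodule.Quotient.mk_eq_zero]
    exact Submodule.smul_mem_pointwise_smul _ _ _ trivial

theorem ringKrullDim_quotient_add_one_le {R : Type*} [CommRing R] {P Q : Ideal R} [P.IsPrime]
    (hPQ : P ≤ Q) {x : R} (hxQ : x ∈ Q) (hxP : x ∉ P) :
    ringKrullDim (R ⧸ Q) + 1 ≤ ringKrullDim (R ⧸ P) :=
  ringKrullDim_succ_le_of_surjective (Ideal.Quotient.factor hPQ)
    (Ideal.Quotient.factor_surjective hPQ) (r := Ideal.Quotient.mk P x)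
    (mem_nonZeroDivisors_of_ne_zero (by rwa [Ne, Ideal.Quotient.eq_zero_iff_mem]))
    (by rw [Ideal.Quotient.factor_mk, Ideal.Quotient.eq_zero_iff_mem]; exact hxQ)

/-- The depth is at most the dimension of `R / P` for every associated prime `P`. -/
theorem HasDepthAtLeast.le_ringKrullDim_quotient {n : ℕ} {M : Type*} [AddCommGroup M]
    [Module R M] [Module.Finite R M] (h : HasDepthAtLeast R M n)
    {P : Ideal R} (hP : P ∈ associatedPrimes R M) : (n : WithBot ℕ∞) ≤ ringKrullDim (R ⧸ P) := by
  induction n generalizing M P with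
  | zero =>
    have := Ideal.Quotient.nontrivial_iff.mpr (IsAssociatedPrime.isPrime hP).ne_top
    exact ringKrullDim_nonneg_of_nontrivial
  | succ n ih =>
    obtain ⟨x, hx, hr, hd⟩ := hasDepthAtLeast_succ_iff.mp h
    obtain ⟨Q, hQ, hPQ, hxQ⟩ := exists_associatedPrime_quotSMulTop hx hr hP
    have := IsAssociatedPrime.isPrime hP
    refine le_trans ?_ (ringKrullDim_quotient_add_one_le hPQ hxQ fun hxP => ?_)
    · push_cast
      gcongr
      exact ih hd hQ
    · have : x ∈ ⋃ p ∈ associatedPrimes R M, (p : Set R) := Set.mem_biUnion hP hxP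
      rw [biUnion_associatedPrimes_eq_compl_regular R M] at this
      exact this hr

theorem HasDepthAtLeast.le_ringKrullDim {n : ℕ} [Nontrivial M] [Module.Finite R M]
    (h : HasDepthAtLeast R M n) : (n : WithBot ℕ∞) ≤ ringKrullDim R := by
  obtain ⟨P, hP⟩ := associatedPrimes.nonempty R M
  exact (h.le_ringKrullDim_quotient hP).trans (ringKrullDim_quotient_le P)

theorem exists_natCast_eq_ringKrullDim (R : Type*) [CommRing R] [IsLocalRing R]
    [IsNoetherianRing R] : ∃ d : ℕ, ringKrullDim R = d := by
  obtain ⟨a, ha⟩ := WithBot.ne_bot_iff_exists.mp (ringKrullDim_ne_bot (R := R))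
  have : a ≠ ⊤ := by
    rintro rfl
    exact ringKrullDim_ne_top (R := R) ha.symm
  obtain ⟨d, rfl⟩ := ENat.ne_top_iff_exists.mp this
  exact ⟨d, ha.symm⟩

/-- Killing one element lowers the dimension by at most one; once all are killed, the maximal ideal
is nilpotent and hence the only prime. -/
theorem ringKrullDim_quotient_le_length {I : Ideal R} {xs : List R} {t : ℕ}
    (hxs : ∀ x ∈ xs, x ∈ maximalIdeal R)
    (h : maximalIdeal R ^ t ≤ Ideal.ofList xs ⊔ I) :
    ringKrullDim (R ⧸ I) ≤ xs.length := by
  induction xs generalizing I with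
  | nil =>
    have hsub : Subsingleton (PrimeSpectrum.zeroLocus (R := R) I) := by
      refine ⟨fun ⟨p, hp⟩ ⟨q, hq⟩ => Subtype.ext ?_⟩
      have key : ∀ p : PrimeSpectrum R, p ∈ PrimeSpectrum.zeroLocus (R := R) I →
          p.asIdeal = maximalIdeal R := fun p hp => by
        refine (le_maximalIdeal p.2.ne_top).antisymm (p.2.le_of_pow_le (n := t) (h.trans ?_))
        simpa using hp
      exact PrimeSpectrum.ext ((key p hp).trans (key q hq).symm)
    rw [ringKrullDim_quotient]
    simpa using Order.krullDim_nonpos_of_subsingleton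
  | cons x xs ih =>
    have h1 := ih (I := I ⊔ Ideal.span {x}) (fun y hy => hxs y (by simp [hy])) (by
      rw [Ideal.ofList_cons] at h
      refine h.trans (le_of_eq ?_)
      ac_rfl)
    have h2 := Module.supportDim_le_supportDim_quotSMulTop_succ (M := R ⧸ I) (hxs x (by simp))
    let f : R →ₗ[R] QuotSMulTop x (R ⧸ I) := (Submodule.mkQ _).comp (Submodule.mkQ I)
    have hf : Function.Surjective f :=
      (Submodule.mkQ_surjective _).comp (Submodule.mkQ_surjective _)
    have hle : I ⊔ Ideal.span {x} ≤ LinearMap.ker f := by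
      refine sup_le (fun r hr => ?_) ((Ideal.span_singleton_le_iff_mem _).mpr ?_)
      · rw [LinearMap.mem_ker, LinearMap.comp_apply, Submodule.mkQ_apply I,
          (Submodule.Quotient.mk_eq_zero I (x := r)).mpr hr, map_zero]
      · rw [LinearMap.mem_ker, LinearMap.comp_apply, Submodule.mkQ_apply,
          Submodule.Quotient.mk_eq_zero, Submodule.mem_smul_pointwise_iff_exists]
        refine ⟨Submodule.mkQ I 1, trivial, ?_⟩
        rw [← map_smul, smul_eq_mul, mul_one]
    have h3 := Module.supportDim_le_of_surjective (Submodule.liftQ _ f hle)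
      (by
        intro y
        obtain ⟨r, rfl⟩ := hf y
        exact ⟨Submodule.mkQ _ r, rfl⟩)
    rw [Module.supportDim_quotient_eq_ringKrullDim] at h2 h3
    refine h2.trans ?_
    rw [List.length_cons]
    push_cast
    gcongr
    exact h3.trans h1

/-- A system of parameters is a regular sequence on a module of maximal depth. -/
theorem HasDepthAtLeast.isWeaklyRegular {M : Type*} [AddCommGroup M] [Module R M]
    [Module.Finite R M] {xs : List R} {t : ℕ} (h : HasDepthAtLeast R M xs.length)
    (hxs : ∀ x ∈ xs, x ∈ maximalIdeal R)
    (ht : maximalIdeal R ^ t ≤ Ideal.ofList xs ⊔ Module.annihilator R M) :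
    IsWeaklyRegular M xs := by
  induction xs generalizing M with
  | nil => exact .nil R M
  | cons x xs ih =>
    have hr : IsSMulRegular M x := by
      by_contra hcon
      have : x ∈ ⋃ p ∈ associatedPrimes R M, (p : Set R) := by
        rwa [biUnion_associatedPrimes_eq_compl_regular R M]
      obtain ⟨P, hP, hxP⟩ := Set.mem_iUnion₂.mp this
      have h1 := h.le_ringKrullDim_quotient hP
      -- Both x and the annihilator lie in P, so the remaining `xs` alone cut R/P down to dimension
      -- zero. This contradicts the depth bound, which exceeds their number by one.
      have h2 : ringKrullDim (R ⧸ P) ≤ xs.length := by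
        refine ringKrullDim_quotient_le_length (t := t) (fun y hy => hxs y (by simp [hy]))
          (ht.trans ?_)
        rw [Ideal.ofList_cons]
        refine sup_le (sup_le ?_ le_sup_left) ?_
        · exact ((Ideal.span_singleton_le_iff_mem _).mpr hxP).trans le_sup_right
        · refine le_trans ?_ le_sup_right
          rw [← Submodule.annihilator_top]
          exact IsAssociatedPrime.annihilator_le hP
      have h3 := h1.trans h2
      norm_cast at h3
      simp at h3
    refine .cons hr (ih ?_ (fun y hy => hxs y (by simp [hy])) (ht.trans ?_))
    · exact HasDepthAtLeast.quotSMulTop h (hxs x (by simp)) hr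
    · rw [Ideal.ofList_cons]
      refine sup_le (sup_le ?_ le_sup_left) ?_
      · refine le_trans ?_ le_sup_right
        exact (Ideal.span_singleton_le_iff_mem _).mpr (QuotSMulTop.mem_annihilator M x)
      · exact le_trans (LinearMap.annihilator_le_of_surjective _ (Submodule.mkQ_surjective _))
          le_sup_right

end Depth

/-! ### Regular local rings and dimension under integral extensions -/

/-- If the maximal ideal is generated by an `M`-regular sequence, then `M` is free. -/
theorem module_free_of_isWeaklyRegular (n : ℕ) : ∀ (R : Type u) (M : Type v) [CommRing R]
    [IsLocalRing R] [IsNoetherianRing R] [AddCommGroup M] [Module R M] [Module.Finite R M]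
    (xs : List R), xs.length = n → Ideal.ofList xs = maximalIdeal R → IsWeaklyRegular M xs →
    Module.Free R M := by
  induction n with
  | zero =>
    intro R M _ _ _ _ _ _ xs hn hm _
    obtain rfl := List.length_eq_zero_iff.mp hn
    have hf : IsField R := isField_iff_maximalIdeal_eq.mpr (by rw [← hm, Ideal.ofList_nil])
    let := hf.toField
    exact Module.Free.of_divisionRing R M
  | succ n ih =>
    intro R M _ _ _ _ _ _ xs hn hm hr
    obtain _ | ⟨x, xs⟩ := xs
    · simp at hn
    have hx : x ∈ maximalIdeal R := by
      rw [← hm, Ideal.ofList_cons]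
      exact Submodule.mem_sup_left (Ideal.mem_span_singleton_self x)
    have : Nontrivial (R ⧸ Ideal.span {x}) := Ideal.Quotient.nontrivial_iff.mpr
      (fun h => (maximalIdeal.isMaximal R).ne_top (top_le_iff.mp
        (h ▸ (Ideal.span_singleton_le_iff_mem _).mpr hx)))
    have hloc : IsLocalRing (R ⧸ Ideal.span {x}) :=
      .of_surjective' (Ideal.Quotient.mk _) Ideal.Quotient.mk_surjective
    rw [isWeaklyRegular_cons_iff'] at hr
    have := Module.finitePresentation_of_finite R M
    rw [← Module.free_quotSMulTop_iff_free R M (x := x) (maximalIdeal_le_jacobson _ hx) hr.1]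
    have : Module.Finite (R ⧸ Ideal.span {x}) (QuotSMulTop x M) :=
      Module.Finite.of_restrictScalars_finite R _ _
    refine ih _ _ (xs.map (Ideal.Quotient.mk (Ideal.span {x}))) (by simpa using hn) ?_ hr.2
    rw [← Ideal.map_ofList]
    have h1 : (maximalIdeal R).map (Ideal.Quotient.mk (Ideal.span {x})) = maximalIdeal _ :=
      map_maximalIdeal_of_surjective _ Ideal.Quotient.mk_surjective
    rw [← h1, ← hm, Ideal.ofList_cons, Ideal.map_sup, Ideal.map_quotient_self, bot_sup_eq]

/-- Exchange argument: outside the square of the maximal ideal, y must have a unit coefficient at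
some generator, which it can therefore replace. -/
theorem span_singleton_sup_span_succAbove {A : Type*} [CommRing A] [IsLocalRing A] {n : ℕ}
    {x : Fin (n + 1) → A} {y : A} (hx : Ideal.span (Set.range x) = maximalIdeal A)
    (hy : y ∈ maximalIdeal A) (hy2 : y ∉ maximalIdeal A ^ 2) :
    ∃ i : Fin (n + 1),
      Ideal.span {y} ⊔ Ideal.span (Set.range (x ∘ i.succAbove)) = maximalIdeal A := by
  have hxm : ∀ i, x i ∈ maximalIdeal A := fun i => hx ▸ Ideal.subset_span ⟨i, rfl⟩
  obtain ⟨c, hc⟩ := (Ideal.mem_span_range_iff_exists_fun).mp (hx ▸ hy)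
  obtain ⟨i, hi⟩ : ∃ i, c i ∉ maximalIdeal A := by
    by_contra! hcon
    refine hy2 (hc ▸ Ideal.sum_mem _ fun i _ => ?_)
    rw [pow_two]
    exact Ideal.mul_mem_mul (hcon i) (hxm i)
  refine ⟨i, le_antisymm (sup_le ((Ideal.span_singleton_le_iff_mem _).mpr hy)
    (Ideal.span_le.mpr ?_)) ?_⟩
  · rintro _ ⟨j, rfl⟩
    exact hxm _
  rw [← hx, Ideal.span_le]
  have hj : ∀ j, x (i.succAbove j) ∈
      Ideal.span {y} ⊔ Ideal.span (Set.range (x ∘ i.succAbove)) := fun j =>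
    Submodule.mem_sup_right (Ideal.subset_span ⟨j, rfl⟩)
  rintro _ ⟨k, rfl⟩
  rcases Fin.eq_self_or_eq_succAbove i k with rfl | ⟨j, rfl⟩
  · have hu : IsUnit (c k) := by simpa using hi
    rw [SetLike.mem_coe, ← Ideal.unit_mul_mem_iff_mem _ hu]
    rw [Fin.sum_univ_succAbove _ k] at hc
    rw [eq_sub_of_add_eq hc]
    exact sub_mem (Submodule.mem_sup_left (Ideal.mem_span_singleton_self y))
      (Ideal.sum_mem _ fun j _ => Ideal.mul_mem_left _ _ (hj j))
  · exact hj j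

/-- A Noetherian local ring whose maximal ideal is generated by `n ≤ dim A` elements is a domain
of depth at least `n`. -/
theorem isDomain_and_hasDepthAtLeast (n : ℕ) : ∀ (A : Type u) [CommRing A] [IsLocalRing A]
    [IsNoetherianRing A] (x : Fin n → A), Ideal.span (Set.range x) = maximalIdeal A →
    (n : WithBot ℕ∞) ≤ ringKrullDim A → IsDomain A ∧ HasDepthAtLeast A A n := by
  induction n with
  | zero =>
    intro A _ _ _ x hx _
    have hf : IsField A := isField_iff_maximalIdeal_eq.mpr (by rw [← hx]; simp)
    exact ⟨hf.isDomain, hasDepthAtLeast_zero⟩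
  | succ n ih =>
    intro A _ _ _ x hx hdim
    have hfin : (minimalPrimes A).Finite := minimalPrimes.finite_of_isNoetherianRing A
    -- Prime avoidance tolerates the one possibly non-prime ideal `maximalIdeal A ^ 2`.
    obtain ⟨y, hym, hy2, hymin⟩ : ∃ y ∈ maximalIdeal A, y ∉ maximalIdeal A ^ 2 ∧
        ∀ q ∈ minimalPrimes A, y ∉ q := by
      by_contra! hcon
      have hsub : (maximalIdeal A : Set A) ⊆
          ⋃ i ∈ insert (maximalIdeal A ^ 2) (minimalPrimes A), (i : Set A) := by
        intro y hy
        by_cases h2 : y ∈ maximalIdeal A ^ 2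
        · exact Set.mem_biUnion (Set.mem_insert _ _) h2
        · obtain ⟨q, hq, hyq⟩ := hcon y hy h2
          exact Set.mem_biUnion (Set.mem_insert_of_mem _ hq) hyq
      obtain ⟨I, hI, hmI⟩ := (Ideal.subset_union_prime_finite (hfin.insert _) (f := id)
        (maximalIdeal A ^ 2) (maximalIdeal A ^ 2) (by
          rintro i (rfl | hi) h _
          · exact absurd rfl h
          · exact Ideal.IsMinimalPrime.isPrime hi)).mp hsub
      have h0 : ringKrullDim A ≠ 0 := by
        intro h0
        rw [h0] at hdim
        norm_cast at hdim
      rcases hI with rfl | hI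
      · exact (maximalIdeal_sq_lt_of_ringKrullDim_ne_zero h0).not_ge hmI
      · have hp := Ideal.IsMinimalPrime.isPrime hI
        have : I = maximalIdeal A := (le_maximalIdeal hp.ne_top).antisymm hmI
        subst this
        rw [← maximalIdeal_height_eq_ringKrullDim, Ideal.height_eq_zero_iff.mpr hI] at h0
        exact h0 rfl
    obtain ⟨i, hi⟩ := span_singleton_sup_span_succAbove hx hym hy2
    have : Nontrivial (A ⧸ Ideal.span {y}) := Ideal.Quotient.nontrivial_iff.mpr
      (fun h => (maximalIdeal.isMaximal A).ne_top (top_le_iff.mp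
        (h ▸ (Ideal.span_singleton_le_iff_mem _).mpr hym)))
    have hloc : IsLocalRing (A ⧸ Ideal.span {y}) :=
      .of_surjective' (Ideal.Quotient.mk _) Ideal.Quotient.mk_surjective
    have hmap : (maximalIdeal A).map (Ideal.Quotient.mk (Ideal.span {y})) = maximalIdeal _ :=
      map_maximalIdeal_of_surjective _ Ideal.Quotient.mk_surjective
    obtain ⟨hdom, rs, hlen, hrs, hreg⟩ := ih (A ⧸ Ideal.span {y})
      (Ideal.Quotient.mk _ ∘ x ∘ i.succAbove) (by
        rw [Set.range_comp, ← Ideal.map_span, ← hmap, ← hi, Ideal.map_sup,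
          Ideal.map_quotient_self, bot_sup_eq]) (by
        have h1 := Ideal.height_le_ringKrullDim_quotient_add_one hym
        rw [maximalIdeal_height_eq_ringKrullDim] at h1
        have h2 := hdim.trans h1
        obtain ⟨e, he⟩ := exists_natCast_eq_ringKrullDim (A ⧸ Ideal.span {y})
        rw [he] at h2 ⊢
        norm_cast at h2 ⊢
        omega)
    have hprime : (Ideal.span {y}).IsPrime := (Ideal.Quotient.isDomain_iff_prime _).mp hdom
    -- A minimal prime q below the prime (y) does not contain y, so every element yb of q has b ∈ q.
    -- Thus q = yq, and Nakayama gives q = 0.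
    have hbot : (⊥ : Ideal A).IsPrime := by
      obtain ⟨q, hq, hqy⟩ := Ideal.exists_minimalPrimes_le (bot_le (a := Ideal.span {y}))
      have hqp := Ideal.IsMinimalPrime.isPrime hq
      have hle : q ≤ maximalIdeal A • q := by
        intro a ha
        obtain ⟨b, rfl⟩ := Ideal.mem_span_singleton'.mp (hqy ha)
        rw [mul_comm]
        exact Submodule.smul_mem_smul hym ((hqp.mem_or_mem ha).resolve_right (hymin q hq))
      rwa [Submodule.eq_bot_of_le_smul_of_le_jacobson_bot (maximalIdeal A) q
        (IsNoetherian.noetherian q) hle (maximalIdeal_le_jacobson _)] at hqp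
    have hA : IsDomain A := by
      have := Ideal.Quotient.isDomain (⊥ : Ideal A)
      exact (RingEquiv.quotientBot A).symm.toMulEquiv.isDomain _
    refine ⟨hA, hasDepthAtLeast_succ_iff.mpr ⟨y, hym, ?_, ?_⟩⟩
    · have hy0 : y ≠ 0 := by rintro rfl; exact hy2 (zero_mem _)
      exact fun a b h => mul_left_cancel₀ hy0 h
    · choose g hg using Ideal.Quotient.mk_surjective (I := Ideal.span {y})
      have hrs' : rs = (rs.map g).map (algebraMap A (A ⧸ Ideal.span {y})) := by
        rw [List.map_map]
        conv_lhs => rw [← List.map_id rs]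
        exact List.map_congr_left fun a _ => (hg a).symm
      have : HasDepthAtLeast A (A ⧸ Ideal.span {y}) n := by
        refine ⟨rs.map g, by simpa using hlen, fun r hr => ?_, ?_⟩
        · obtain ⟨a, ha, rfl⟩ := List.mem_map.mp hr
          have := hrs a ha
          rw [mem_maximalIdeal, mem_nonunits_iff] at this ⊢
          exact fun hu => this (hg a ▸ hu.map (Ideal.Quotient.mk _))
        · rw [hrs'] at hreg
          exact (isWeaklyRegular_map_algebraMap_iff _ _ _).mp hreg
      exact this.of_linearEquiv (Submodule.quotEquivOfEq _ _ (by
        rw [← Submodule.ideal_span_singleton_smul]; simp))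

theorem IsRegularLocalRing.exists_ofList_eq_maximalIdeal (A : Type*) [CommRing A]
    [IsRegularLocalRing A] : ∃ xs : List A, (xs.length : WithBot ℕ∞) = ringKrullDim A ∧
      Ideal.ofList xs = maximalIdeal A ∧ HasDepthAtLeast A A xs.length := by
  obtain ⟨s, hcard, hspan⟩ := Submodule.FG.exists_span_finset_card_eq_spanFinrank
    (IsNoetherian.noetherian (maximalIdeal A))
  have hdim := IsRegularLocalRing.spanFinrank_maximalIdeal (R := A)
  have hl : Ideal.ofList s.toList = maximalIdeal A := by
    rw [← hspan, Ideal.ofList]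
    congr 1
    ext
    simp
  have hd : (s.toList.length : WithBot ℕ∞) = ringKrullDim A := by
    rw [← hdim, ← hcard, Finset.length_toList]
  refine ⟨s.toList, hd, hl, (isDomain_and_hasDepthAtLeast _ A s.toList.get ?_ hd.le).2⟩
  rw [← hl, Set.range_list_get, Ideal.ofList]

theorem HasDepthAtLeast.of_isLocalHom {R S M : Type*} [CommRing R] [CommRing S] [IsLocalRing R]
    [IsLocalRing S] [Algebra R S] [IsLocalHom (algebraMap R S)] [AddCommGroup M] [Module R M]
    [Module S M] [IsScalarTower R S M] {n : ℕ} (h : HasDepthAtLeast R M n) :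
    HasDepthAtLeast S M n := by
  obtain ⟨rs, h1, h2, h3⟩ := h
  refine ⟨rs.map (algebraMap R S), by simpa using h1, fun s hs => ?_,
    (isWeaklyRegular_map_algebraMap_iff _ _ _).mpr h3⟩
  obtain ⟨r, hr, rfl⟩ := List.mem_map.mp hs
  exact (map_nonunit (algebraMap R S) r (h2 r hr))

/-- Lying over lifts the bottom of a chain of primes, and going up lifts the rest. -/
theorem ringKrullDim_le_of_isIntegral (R S : Type*) [CommRing R] [CommRing S] [Algebra R S]
    [Algebra.IsIntegral R S] [FaithfulSMul R S] : ringKrullDim R ≤ ringKrullDim S := by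
  refine iSup_le fun l => ?_
  obtain ⟨Q, -, hQ, hover⟩ := Ideal.exists_ideal_over_prime_of_isIntegral l.head.asIdeal
    (⊥ : Ideal S) (fun r hr => by
      rw [Ideal.mem_comap, Ideal.mem_bot, FaithfulSMul.algebraMap_eq_zero_iff] at hr
      exact hr ▸ zero_mem _)
  have : Q.LiesOver l.head.asIdeal := ⟨hover.symm⟩
  obtain ⟨L, hL, -⟩ := Ideal.exists_ltSeries_of_hasGoingUp l Q
  exact le_iSup_of_le L (by rw [hL])

/-! ### Powers of an ideal generated by a regular sequence -/

section Powers

variable {R M : Type*} [CommRing R] [AddCommGroup M] [Module R M]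

/-- A product of n + 1 factors from (x) and J either involves x or lies in Jⁿ⁺¹. -/
theorem Ideal.span_singleton_sup_pow_succ_le (x : R) (J : Ideal R) (n : ℕ) :
    (Ideal.span {x} ⊔ J) ^ (n + 1) ≤
      Ideal.span {x} * (Ideal.span {x} ⊔ J) ^ n ⊔ J ^ (n + 1) := by
  induction n with
  | zero => simp
  | succ n ih =>
    rw [pow_succ' _ (n + 1), Ideal.sup_mul]
    refine sup_le le_sup_left ((Ideal.mul_mono_right ih).trans ?_)
    rw [Ideal.mul_sup]
    refine sup_le (le_sup_of_le_left ?_) (le_sup_of_le_right (pow_succ' J (n + 1)).ge)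
    rw [mul_left_comm, pow_succ' _ n]
    exact Ideal.mul_mono_right (Ideal.mul_mono_left le_sup_right)

/-- Write xu = xw + v with w ∈ IⁿM and v ∈ Jⁿ⁺¹M, where I = (x) + J. Then x(u − w) ∈ Jⁿ⁺¹M, so u − w
∈ Jⁿ⁺¹M ⊆ IⁿM. -/
theorem mem_pow_smul_top_of_smul_mem_pow_succ_smul_top {x : R} {J : Ideal R}
    (h : ∀ (n : ℕ) (u : M), x • u ∈ (J ^ n • ⊤ : Submodule R M) →
      u ∈ (J ^ n • ⊤ : Submodule R M)) (n : ℕ) (u : M)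
    (hu : x • u ∈ ((Ideal.span {x} ⊔ J) ^ (n + 1) • ⊤ : Submodule R M)) :
    u ∈ ((Ideal.span {x} ⊔ J) ^ n • ⊤ : Submodule R M) := by
  have h1 := Submodule.smul_mono_left (N := (⊤ : Submodule R M))
    (Ideal.span_singleton_sup_pow_succ_le x J n) hu
  rw [Submodule.sup_smul, Submodule.mul_smul, Submodule.ideal_span_singleton_smul,
    Submodule.mem_sup] at h1
  obtain ⟨a, ha, v, hv, e⟩ := h1
  obtain ⟨w, hw, rfl⟩ := (Submodule.mem_smul_pointwise_iff_exists _ _ _).mp ha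
  have h2 := h (n + 1) (u - w) (by rwa [smul_sub, ← e, add_sub_cancel_left])
  have h3 : J ^ (n + 1) ≤ (Ideal.span {x} ⊔ J) ^ n :=
    (Ideal.pow_le_pow_right n.le_succ).trans (Ideal.pow_right_mono le_sup_right n)
  have := add_mem (Submodule.smul_mono_left h3 h2) hw
  rwa [sub_add_cancel] at this

theorem mkQ_mem_smul_top_iff {x : R} {J : Ideal R} {u : M} :
    Submodule.mkQ (x • (⊤ : Submodule R M)) u ∈ (J • ⊤ : Submodule R (QuotSMulTop x M)) ↔
      u ∈ (J • ⊤ ⊔ x • ⊤ : Submodule R M) := by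
  have := Submodule.comap_smul_top_of_surjective J _ (Submodule.mkQ_surjective
    (x • (⊤ : Submodule R M)))
  rw [Submodule.ker_mkQ] at this
  rw [← this, Submodule.mem_comap]

theorem pow_smul_top_le_sup (x : R) (J : Ideal R) (n : ℕ) :
    ((Ideal.span {x} ⊔ J) ^ n • ⊤ : Submodule R M) ≤ J ^ n • ⊤ ⊔ x • ⊤ := by
  have : (Ideal.span {x} ⊔ J) ^ n ≤ J ^ n ⊔ Ideal.span {x} := by
    cases n with
    | zero => simp
    | succ n =>
      refine (Ideal.span_singleton_sup_pow_succ_le x J n).trans (sup_le ?_ le_sup_left)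
      exact le_sup_of_le_right Ideal.mul_le_left
  refine (Submodule.smul_mono_left this).trans ?_
  rw [Submodule.sup_smul, Submodule.ideal_span_singleton_smul]

variable [IsLocalRing R] [IsNoetherianRing R]

/-- An element regular on `M / IM`, where `I` is generated by an `M`-regular sequence, is regular
on all `M / IⁿM`. -/
theorem mem_pow_smul_top_of_smul_mem {M : Type*} [AddCommGroup M] [Module R M]
    [Module.Finite R M] {xs : List R} {y : R} (hxs : ∀ x ∈ xs, x ∈ maximalIdeal R)
    (hy : y ∈ maximalIdeal R) (h : IsWeaklyRegular M (xs ++ [y])) (n : ℕ) (u : M)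
    (hu : y • u ∈ (Ideal.ofList xs ^ n • ⊤ : Submodule R M)) :
    u ∈ (Ideal.ofList xs ^ n • ⊤ : Submodule R M) := by
  induction xs generalizing M y n u with
  | nil =>
    cases n with
    | zero => simp
    | succ n =>
      rw [Ideal.ofList_nil, Ideal.bot_pow n.succ_ne_zero, Submodule.bot_smul,
        Submodule.mem_bot] at hu ⊢
      rw [List.nil_append, isWeaklyRegular_cons_iff] at h
      exact h.1.eq_zero_of_smul_eq_zero hu
  | cons x xs ih =>
    have hx : x ∈ maximalIdeal R := hxs x (by simp)
    have hxs' : ∀ x ∈ xs, x ∈ maximalIdeal R := fun z hz => hxs z (by simp [hz])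
    have h1 : IsWeaklyRegular M (xs ++ [x]) := by
      have h2 : IsWeaklyRegular M (x :: xs) := by
        rw [isWeaklyRegular_append_iff] at h
        exact h.1
      exact isWeaklyRegular_of_perm_of_subset_maximalIdeal h2
        (List.perm_append_singleton x xs).symm hxs
    -- The outer induction hypothesis, with x in the role of y, makes x cancellable from Iⁿ⁺¹M into
    -- IⁿM for the full ideal I.
    have hB := mem_pow_smul_top_of_smul_mem_pow_succ_smul_top
      (fun n u => ih hxs' hx h1 n u)
    rw [List.cons_append, isWeaklyRegular_cons_iff] at h
    rw [Ideal.ofList_cons] at hu ⊢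
    induction n generalizing u with
    | zero => simp
    | succ n ihn =>
      -- Working modulo x gives u = v + xw with v already in Iⁿ⁺¹M. It remains to see w ∈ IⁿM:
      -- cancel x from xyw by `hB`, then y by the inner induction.
      have h2 := mkQ_mem_smul_top_iff.mp (ih hxs' hy h.2 (n + 1) (Submodule.mkQ _ u) (by
        rw [← map_smul]
        exact mkQ_mem_smul_top_iff.mpr (pow_smul_top_le_sup _ _ _ hu)))
      obtain ⟨v, hv, a, ha, rfl⟩ := Submodule.mem_sup.mp h2
      obtain ⟨w, -, rfl⟩ := (Submodule.mem_smul_pointwise_iff_exists _ _ _).mp ha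
      have hv' : v ∈ ((Ideal.span {x} ⊔ Ideal.ofList xs) ^ (n + 1) • ⊤ : Submodule R M) :=
        Submodule.smul_mono_left (Ideal.pow_right_mono le_sup_right _) hv
      have h3 : x • y • w ∈ ((Ideal.span {x} ⊔ Ideal.ofList xs) ^ (n + 1) • ⊤ :
          Submodule R M) := by
        have := sub_mem hu (Submodule.smul_mem _ y hv')
        rwa [smul_add, add_sub_cancel_left, smul_comm] at this
      refine add_mem hv' ?_
      have h4 := ihn w (hB n _ h3)
      rw [pow_succ', Submodule.mul_smul]
      exact Submodule.smul_mem_smul (Submodule.mem_sup_left (Ideal.mem_span_singleton_self x)) h4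

/-- The Hilbert–Samuel function of an ideal generated by an `M`-regular sequence. -/
theorem length_quotient_ofList_pow_smul_top {M : Type*} [AddCommGroup M] [Module R M]
    [Module.Finite R M] {xs : List R} (hxs : ∀ x ∈ xs, x ∈ maximalIdeal R)
    (h : IsWeaklyRegular M xs) (k : ℕ) :
    Module.length R (M ⧸ (Ideal.ofList xs ^ (k + 1) • ⊤ : Submodule R M)) =
      (k + xs.length).choose xs.length *
        Module.length R (M ⧸ (Ideal.ofList xs • ⊤ : Submodule R M)) := by
  induction xs generalizing M k with
  | nil =>
    have h0 : (Ideal.ofList [] : Ideal R) ^ (k + 1) = Ideal.ofList [] := by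
      rw [Ideal.ofList_nil, Ideal.bot_pow k.succ_ne_zero]
    rw [h0]
    simp
  | cons x xs ih =>
    have hx : x ∈ maximalIdeal R := hxs x (by simp)
    have hxs' : ∀ x ∈ xs, x ∈ maximalIdeal R := fun z hz => hxs z (by simp [hz])
    have h1 : IsWeaklyRegular M (xs ++ [x]) :=
      isWeaklyRegular_of_perm_of_subset_maximalIdeal h
        (List.perm_append_singleton x xs).symm hxs
    have hB := mem_pow_smul_top_of_smul_mem_pow_succ_smul_top
      (mem_pow_smul_top_of_smul_mem hxs' hx h1)
    rw [isWeaklyRegular_cons_iff] at h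
    rw [← Ideal.ofList_cons] at hB
    induction k with
    | zero =>
      rw [zero_add, pow_one]
      simp
    | succ k ihk =>
      set I := Ideal.ofList (x :: xs) with hI
      rw [Ideal.ofList_cons] at hI
      let p := (I ^ (k + 1) • ⊤ : Submodule R M)
      let q := (I ^ (k + 2) • ⊤ : Submodule R M)
      let r := (Ideal.ofList xs ^ (k + 2) • ⊤ : Submodule R (QuotSMulTop x M))
      have hxI : x ∈ I := hI ▸ Submodule.mem_sup_left (Ideal.mem_span_singleton_self x)
      -- With M' = M/xM and I' = (xs), the sequence 0 → M/Iᵏ⁺¹M → M/Iᵏ⁺²M → M'/I'ᵏ⁺²M' → 0, whose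
      -- first map is multiplication by x, is exact. Additivity of length becomes Pascal's rule.
      let f : M ⧸ p →ₗ[R] M ⧸ q := Submodule.mapQ p q (LinearMap.lsmul R M x) (fun u hu => by
        change x • u ∈ (I ^ (k + 1 + 1) • ⊤ : Submodule R M)
        rw [pow_succ' I, Submodule.mul_smul]
        exact Submodule.smul_mem_smul hxI hu)
      let g : M ⧸ q →ₗ[R] QuotSMulTop x M ⧸ r := Submodule.mapQ q r (Submodule.mkQ _)
        (fun u hu => mkQ_mem_smul_top_iff.mpr (pow_smul_top_le_sup _ _ _ (hI ▸ hu)))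
      have hf : Function.Injective f := by
        rw [← LinearMap.ker_eq_bot, LinearMap.ker_eq_bot']
        intro u hu
        obtain ⟨u, rfl⟩ := Submodule.mkQ_surjective _ u
        have : x • u ∈ q := (Submodule.Quotient.mk_eq_zero q).mp hu
        exact (Submodule.Quotient.mk_eq_zero p).mpr (hB (k + 1) u this)
      have hg : Function.Surjective g := by
        intro u
        obtain ⟨u, rfl⟩ := Submodule.mkQ_surjective _ u
        obtain ⟨u, rfl⟩ := Submodule.mkQ_surjective _ u
        exact ⟨Submodule.mkQ _ u, rfl⟩
      have hfg : Function.Exact f g := by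
        intro u
        obtain ⟨u, rfl⟩ := Submodule.mkQ_surjective _ u
        constructor
        · intro hu
          have : Submodule.mkQ (x • (⊤ : Submodule R M)) u ∈ r :=
            (Submodule.Quotient.mk_eq_zero r).mp hu
          obtain ⟨v, hv, a, ha, rfl⟩ := Submodule.mem_sup.mp (mkQ_mem_smul_top_iff.mp this)
          obtain ⟨w, -, rfl⟩ := (Submodule.mem_smul_pointwise_iff_exists _ _ _).mp ha
          refine ⟨Submodule.mkQ _ w, ?_⟩
          rw [map_add]
          have hv' : Submodule.mkQ q v = 0 := (Submodule.Quotient.mk_eq_zero q).mpr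
            (Submodule.smul_mono_left (Ideal.pow_right_mono (hI ▸ le_sup_right) _) hv)
          rw [hv', zero_add]
          rfl
        · rintro ⟨w, hw⟩
          obtain ⟨w, rfl⟩ := Submodule.mkQ_surjective _ w
          rw [← hw]
          refine (Submodule.Quotient.mk_eq_zero r).mpr (mkQ_mem_smul_top_iff.mpr ?_)
          exact Submodule.mem_sup_right (Submodule.smul_mem_pointwise_smul _ _ _ trivial)
      have e := (Submodule.quotOfListConsSMulTopEquivQuotSMulTopInner M x xs).length_eq
      rw [Module.length_eq_add_of_exact f g hf hg hfg, ihk, ih hxs' h.2 (k + 1), ← e, ← add_mul,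
        List.length_cons, show k + 1 + (xs.length + 1) = (k + 1 + xs.length) + 1 by ring,
        Nat.choose_succ_succ, show k + (xs.length + 1) = k + 1 + xs.length by ring, add_comm]
      push_cast
      rfl

end Powers

/-! ### Multiplicity as the length modulo a parameter reduction -/

section Multiplicity

theorem tendsto_add_const_div_pow (a : ℝ) (d : ℕ) :
    Tendsto (fun n : ℕ => (((n : ℝ) + a) / n) ^ d) atTop (𝓝 1) := by
  have h : Tendsto (fun n : ℕ => 1 + a / (n : ℝ)) atTop (𝓝 (1 + 0)) :=
    tendsto_const_nhds.add (tendsto_const_div_atTop_nhds_zero_nat a)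
  have h2 := h.pow d
  rw [add_zero, one_pow] at h2
  refine h2.congr' ?_
  filter_upwards [eventually_ne_atTop 0] with n hn
  have : (n : ℝ) ≠ 0 := by exact_mod_cast hn
  field_simp

theorem pow_le_factorial_mul_choose (k d : ℕ) :
    (k + 1) ^ d ≤ d.factorial * (k + d).choose d ∧
      d.factorial * (k + d).choose d ≤ (k + d) ^ d := by
  rw [← Nat.ascFactorial_eq_factorial_mul_choose]
  refine ⟨Nat.pow_succ_le_ascFactorial (k + 1) d, ?_⟩
  exact Nat.ascFactorial_le_pow_add k d

/-- A sequence squeezed between shifts of `L * C(k + d, d)` grows like `L * nᵈ / d!`. -/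
theorem tendsto_factorial_mul_div_pow {ℓ : ℕ → ℕ} {L d c : ℕ}
    (hupper : ∀ k, ℓ (k + 1) ≤ (k + d).choose d * L)
    (hlower : ∀ k, (k + d).choose d * L ≤ ℓ (k + 1 + c)) :
    Tendsto (fun n : ℕ => (d.factorial : ℝ) * (ℓ n : ℝ) / (n : ℝ) ^ d) atTop (𝓝 L) := by
  have h1 := (tendsto_add_const_div_pow (-c) d).const_mul (L : ℝ)
  have h2 := (tendsto_add_const_div_pow d d).const_mul (L : ℝ)
  rw [mul_one] at h1 h2
  refine tendsto_of_tendsto_of_tendsto_of_le_of_le' h1 h2 ?_ ?_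
  · filter_upwards [eventually_ge_atTop (c + 1)] with n hn
    obtain ⟨k, rfl⟩ : ∃ k, n = k + 1 + c := ⟨n - c - 1, by omega⟩
    rw [div_pow, ← mul_div_assoc]
    have h3 : L * (k + 1) ^ d ≤ d.factorial * ℓ (k + 1 + c) :=
      calc L * (k + 1) ^ d ≤ L * (d.factorial * (k + d).choose d) :=
            Nat.mul_le_mul_left _ (pow_le_factorial_mul_choose k d).1
        _ = d.factorial * ((k + d).choose d * L) := by ring
        _ ≤ _ := Nat.mul_le_mul_left _ (hlower k)
    refine div_le_div_of_nonneg_right ?_ (by positivity)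
    rw [Nat.cast_add _ c, add_neg_cancel_right]
    exact_mod_cast h3
  · filter_upwards [eventually_ge_atTop 1] with n hn
    obtain ⟨k, rfl⟩ : ∃ k, n = k + 1 := ⟨n - 1, by omega⟩
    rw [div_pow, ← mul_div_assoc]
    have h3 : d.factorial * ℓ (k + 1) ≤ L * (k + 1 + d) ^ d :=
      calc d.factorial * ℓ (k + 1) ≤ d.factorial * ((k + d).choose d * L) :=
            Nat.mul_le_mul_left _ (hupper k)
        _ = L * (d.factorial * (k + d).choose d) := by ring
        _ ≤ L * (k + d) ^ d := Nat.mul_le_mul_left _ (pow_le_factorial_mul_choose k d).2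
        _ ≤ _ := Nat.mul_le_mul_left _ (Nat.pow_le_pow_left (by omega) d)
    refine div_le_div_of_nonneg_right ?_ (by positivity)
    exact_mod_cast h3

variable {R M : Type*} [CommRing R] [AddCommGroup M] [Module R M]

theorem length_quotient_le_of_le {p q : Submodule R M} (h : p ≤ q) :
    Module.length R (M ⧸ q) ≤ Module.length R (M ⧸ p) :=
  Module.length_le_of_surjective (Submodule.factor h) (Submodule.factor_surjective h)

theorem pow_add_eq_pow_mul_of_mul_pow_eq {I J : Ideal R} {c : ℕ} (h : I * J ^ c = J ^ (c + 1)) (n : ℕ) :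
    J ^ (n + c) = I ^ n * J ^ c := by
  induction n with
  | zero => simp
  | succ n ih =>
    rw [show n + 1 + c = (n + c) + 1 by ring, pow_succ', ih, mul_left_comm, ← pow_succ', ← h,
      ← mul_assoc, ← pow_succ]

variable [IsLocalRing R]

theorem HasMultiplicity.unique {e e' : ℝ} (h : HasMultiplicity R M e)
    (h' : HasMultiplicity R M e') : e = e' := by
  obtain ⟨d, hd, h⟩ := h
  obtain ⟨d', hd', h'⟩ := h'
  obtain rfl : d = d' := by
    have := hd.symm.trans hd'
    exact_mod_cast this
  exact tendsto_nhds_unique h h'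

/-- Nakayama turns ν(M) into a length, so it can be compared with e(M) = ℓ(M/IM). -/
theorem spanFinrank_top_eq_length [Module.Finite R M] :
    ((⊤ : Submodule R M).spanFinrank : ℕ∞) =
      Module.length R (M ⧸ (maximalIdeal R • ⊤ : Submodule R M)) := by
  let := Ideal.Quotient.field (maximalIdeal R)
  let N := (⊤ : Submodule R M)
  have hfin : Module.Finite (R ⧸ maximalIdeal R) (N ⧸ (maximalIdeal R • ⊤ : Submodule R N)) :=
    Module.Finite.of_restrictScalars_finite R _ _
  have h1 := IsLocalRing.spanFinrank_eq_finrank_quotient N Module.Finite.fg_top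
  have h2 := Module.length_eq_of_surjective (R := R ⧸ maximalIdeal R) (S := R)
    (M := N ⧸ (maximalIdeal R • ⊤ : Submodule R N)) Ideal.Quotient.mk_surjective
  rw [Module.length_eq_finrank] at h2
  rw [h1, ← h2]
  refine (Submodule.Quotient.equiv _ _ Submodule.topEquiv ?_).length_eq
  rw [Submodule.map_smul'']
  simp

variable [IsNoetherianRing R]

theorem length_quotient_ne_top [Module.Finite R M] {I : Ideal R} {t : ℕ}
    (h : maximalIdeal R ^ t ≤ I) : Module.length R (M ⧸ (I • ⊤ : Submodule R M)) ≠ ⊤ := by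
  have hdim : ringKrullDim (R ⧸ I) ≤ 0 := by
    simpa using ringKrullDim_quotient_le_length (xs := []) (t := t) (I := I) (by simp) (by simpa)
  have : Ring.KrullDimLE 0 (R ⧸ I) := ⟨hdim⟩
  have : IsArtinianRing (R ⧸ I) :=
    isArtinianRing_iff_isNoetherianRing_krullDimLE_zero.mpr ⟨inferInstance, this⟩
  have : Module.Finite (R ⧸ I) (M ⧸ (I • ⊤ : Submodule R M)) :=
    Module.Finite.of_restrictScalars_finite R _ _
  rw [Module.length_eq_of_surjective (R := R ⧸ I) (S := R) Ideal.Quotient.mk_surjective]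
  exact Module.length_ne_top

/-- The multiplicity of a module `M` on which a reduction of the maximal ideal is generated by a
regular sequence of length `dim M`. -/
theorem hasMultiplicity_of_isWeaklyRegular [Module.Finite R M] {xs : List R}
    (hdim : Module.supportDim R M = (xs.length : WithBot ℕ∞))
    (hred : IsIdealReduction (Ideal.ofList xs) (maximalIdeal R)) (h : IsWeaklyRegular M xs) :
    HasMultiplicity R M
      ((Module.length R (M ⧸ (Ideal.ofList xs • ⊤ : Submodule R M))).toNat : ℝ) := by
  obtain ⟨hle, c, hc⟩ := hred
  have hxs : ∀ x ∈ xs, x ∈ maximalIdeal R := fun x hx => hle (Ideal.subset_span hx)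
  -- Together with Iⁿ ⊆ 𝔪ⁿ this traps the Hilbert function of 𝔪 between that of I and its shift by
  -- c.
  have hIc : ∀ n, maximalIdeal R ^ (n + c) ≤ Ideal.ofList xs ^ n := fun n => by
    rw [pow_add_eq_pow_mul_of_mul_pow_eq hc]
    exact Ideal.mul_le_left
  have hfin : ∀ n, Module.length R (M ⧸ (maximalIdeal R ^ n • ⊤ : Submodule R M)) ≠ ⊤ :=
    fun n => length_quotient_ne_top le_rfl
  have hL : Module.length R (M ⧸ (Ideal.ofList xs • ⊤ : Submodule R M)) ≠ ⊤ :=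
    length_quotient_ne_top (t := 1 + c) (by simpa using hIc 1)
  refine ⟨xs.length, hdim, tendsto_factorial_mul_div_pow (c := c) (fun k => ?_) (fun k => ?_)⟩
  · rw [← Nat.cast_le (α := ℕ∞), Nat.cast_mul, ENat.natCast_toNat (hfin _), ENat.natCast_toNat hL,
      ← length_quotient_ofList_pow_smul_top hxs h k]
    exact length_quotient_le_of_le (Submodule.smul_mono_left (Ideal.pow_right_mono hle _))
  · rw [← Nat.cast_le (α := ℕ∞), Nat.cast_mul, ENat.natCast_toNat (hfin _), ENat.natCast_toNat hL,
      ← length_quotient_ofList_pow_smul_top hxs h k]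
    exact length_quotient_le_of_le (Submodule.smul_mono_left (hIc _))

end Multiplicity

/-! ### Reductions, the Rees algebra and superficial elements -/

section Reductions

variable {R : Type*} [CommRing R]

theorem IsIdealReduction.eventually {I J : Ideal R} (h : IsIdealReduction I J) :
    ∃ n₀, ∀ n ≥ n₀, I * J ^ n = J ^ (n + 1) := by
  obtain ⟨-, c, hc⟩ := h
  refine ⟨c, fun n hn => ?_⟩
  obtain ⟨k, rfl⟩ := Nat.exists_eq_add_of_le hn
  rw [pow_add, ← mul_assoc, hc, ← pow_add]
  ring_nf

/-- A finitely generated module over a local ring with infinite residue field is not a finite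
union of proper submodules. -/
theorem exists_forall_notMem_of_infinite_residueField [IsLocalRing R]
    [Infinite (ResidueField R)] {E : Type*} [AddCommGroup E] [Module R E] [Module.Finite R E]
    {s : Set (Submodule R E)} (hs : s.Finite) (htop : ⊤ ∉ s) : ∃ e : E, ∀ p ∈ s, e ∉ p := by
  by_contra! hcon
  -- By B. H. Neumann's lemma some member of a finite cover has finite index. Then E/p is finite,
  -- yet it has a nonzero vector space over the infinite residue field as a quotient.
  obtain ⟨p, hp, hfi⟩ := Submodule.exists_finiteIndex_of_cover (s := hs.toFinset)
    (p := id) (by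
      rw [Set.eq_univ_iff_forall]
      intro e
      obtain ⟨p, hp, he⟩ := hcon e
      exact Set.mem_biUnion (hs.mem_toFinset.mpr hp) he)
  have : p.toAddSubgroup.FiniteIndex := hfi
  have : Finite (E ⧸ p) := AddSubgroup.finite_quotient_of_finiteIndex
  have hne : p ≠ ⊤ := ne_of_mem_of_not_mem (hs.mem_toFinset.mp hp) htop
  have : Nontrivial (E ⧸ p) := Submodule.Quotient.nontrivial_iff.mpr hne
  let F := (E ⧸ p) ⧸ (maximalIdeal R • ⊤ : Submodule R (E ⧸ p))
  have hnt : Nontrivial F := Submodule.Quotient.nontrivial_iff.mpr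
    (Submodule.top_ne_ideal_smul_of_le_jacobson_annihilator (maximalIdeal_le_jacobson _)).symm
  let := Ideal.Quotient.field (maximalIdeal R)
  have : Infinite (R ⧸ maximalIdeal R) := inferInstanceAs (Infinite (ResidueField R))
  have : Infinite F := Module.Free.infinite (R ⧸ maximalIdeal R) F
  have : Finite F := Finite.of_surjective _ (Submodule.mkQ_surjective _)
  exact not_finite F

/-- The ideal `⨁ Jⁿ⁺¹` of the Rees algebra `⨁ Jⁿ`; the quotient is the associated graded ring. -/
noncomputable def reesShiftIdeal (J : Ideal R) : Ideal (reesAlgebra J) where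
  carrier := {f | ∀ i, (f : Polynomial R).coeff i ∈ J ^ (i + 1)}
  add_mem' hf hg i := by
    simpa using add_mem (hf i) (hg i)
  zero_mem' i := by simp
  smul_mem' g f hf i := by
    rw [smul_eq_mul, MulMemClass.coe_mul, Polynomial.coeff_mul]
    refine Ideal.sum_mem _ fun ⟨a, b⟩ hab => ?_
    obtain rfl : a + b = i := by simpa using hab
    rw [add_assoc, pow_add]
    exact Ideal.mul_mem_mul (g.2 a) (hf b)

/-- The monomial `a Xⁿ` of the Rees algebra, for `a ∈ Jⁿ`. -/
noncomputable def reesMonomial {J : Ideal R} (n : ℕ) (a : R) (ha : a ∈ J ^ n) : reesAlgebra J :=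
  ⟨Polynomial.monomial n a, reesAlgebra.monomial_mem.mpr ha⟩

theorem reesMonomial_mul {J : Ideal R} {m n : ℕ} {a b : R} (ha : a ∈ J ^ m) (hb : b ∈ J ^ n) :
    reesMonomial m a ha * reesMonomial n b hb =
      reesMonomial (m + n) (a * b) (pow_add J m n ▸ Ideal.mul_mem_mul ha hb) :=
  Subtype.ext (Polynomial.monomial_mul_monomial ..)

theorem reesMonomial_add {J : Ideal R} {n : ℕ} {a b : R} (ha : a ∈ J ^ n) (hb : b ∈ J ^ n) :
    reesMonomial n (a + b) (add_mem ha hb) = reesMonomial n a ha + reesMonomial n b hb :=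
  Subtype.ext (map_add _ _ _)

theorem reesMonomial_mem_reesShiftIdeal {J : Ideal R} {n : ℕ} {a : R} (ha : a ∈ J ^ n) :
    reesMonomial n a ha ∈ reesShiftIdeal J ↔ a ∈ J ^ (n + 1) := by
  change (∀ i, (Polynomial.monomial n a).coeff i ∈ J ^ (i + 1)) ↔ _
  constructor
  · intro h
    simpa using h n
  · intro h i
    rw [Polynomial.coeff_monomial]
    split_ifs with hi
    · exact hi ▸ h
    · exact zero_mem _

/-- The degree-one monomials of the Rees algebra as a linear map. -/
noncomputable def reesLinear (J : Ideal R) : J →ₗ[R] reesAlgebra J where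
  toFun a := reesMonomial 1 a.1 (by rw [pow_one]; exact a.2)
  map_add' _ _ := Subtype.ext (map_add _ _ _)
  map_smul' _ _ := Subtype.ext (LinearMap.map_smul _ _ _)

/-- The Rees algebra is generated in degree one. -/
theorem reesMonomial_mem_span_range_pow {J : Ideal R} (n : ℕ) {a : R} (ha : a ∈ J ^ n) :
    reesMonomial n a ha ∈ Ideal.span (Set.range (reesLinear J)) ^ n := by
  induction n generalizing a with
  | zero => simp
  | succ n ih =>
    have key : ∀ b ∈ J * J ^ n, ∃ hb : b ∈ J ^ (n + 1),
        reesMonomial (n + 1) b hb ∈ Ideal.span (Set.range (reesLinear J)) ^ (n + 1) := by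
      intro b hb
      refine Submodule.mul_induction_on hb ?_ ?_
      · intro r hr s hs
        refine ⟨pow_succ' J n ▸ Ideal.mul_mem_mul hr hs, ?_⟩
        have e : reesMonomial (n + 1) (r * s) (pow_succ' J n ▸ Ideal.mul_mem_mul hr hs) =
            reesLinear J ⟨r, hr⟩ * reesMonomial n s hs := by
          refine Subtype.ext ?_
          change Polynomial.monomial (n + 1) (r * s) =
            Polynomial.monomial 1 r * Polynomial.monomial n s
          rw [Polynomial.monomial_mul_monomial, add_comm]
        rw [e, pow_succ']
        exact Ideal.mul_mem_mul (Ideal.subset_span ⟨_, rfl⟩) (ih hs)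
      · rintro x y ⟨hx, hx'⟩ ⟨hy, hy'⟩
        exact ⟨add_mem hx hy, reesMonomial_add hx hy ▸ add_mem hx' hy'⟩
    exact (key a (pow_succ' J n ▸ ha)).2

/-- If every degree-one monomial with coefficient in a reduction `I` of `J` lies in the prime `Q`
of the Rees algebra, then so does every degree-one monomial. -/
theorem reesLinear_mem_of_isIdealReduction {I J : Ideal R} (h : IsIdealReduction I J)
    {Q : Ideal (reesAlgebra J)} (hQ : Q.IsPrime)
    (hI : ∀ a (ha : a ∈ I), reesLinear J ⟨a, h.1 ha⟩ ∈ Q) (a : J) : reesLinear J a ∈ Q := by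
  obtain ⟨hle, c, hc⟩ := h
  have key : ∀ b ∈ I * J ^ c, ∃ hb : b ∈ J ^ (1 + c), reesMonomial (1 + c) b hb ∈ Q := by
    intro b hb
    refine Submodule.mul_induction_on hb ?_ ?_
    · intro r hr s hs
      have hr' : r ∈ J ^ 1 := by rw [pow_one]; exact hle hr
      refine ⟨pow_add J 1 c ▸ Ideal.mul_mem_mul hr' hs, ?_⟩
      rw [← reesMonomial_mul hr' hs]
      exact Ideal.mul_mem_right _ _ (hI r hr)
    · rintro x y ⟨hx, hx'⟩ ⟨hy, hy'⟩
      exact ⟨add_mem hx hy, reesMonomial_add hx hy ▸ add_mem hx' hy'⟩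
  -- The power aᶜ⁺¹ lies in Jᶜ⁺¹ = IJᶜ, so (aX)ᶜ⁺¹ ∈ Q.
  obtain ⟨hb, hmem⟩ := key (a.1 ^ (c + 1)) (hc ▸ Ideal.pow_mem_pow a.2 _)
  refine hQ.mem_of_pow_mem (c + 1) ?_
  convert hmem using 1
  refine Subtype.ext ?_
  rw [SubmonoidClass.coe_pow]
  change Polynomial.monomial 1 a.1 ^ (c + 1) = Polynomial.monomial (1 + c) (a.1 ^ (c + 1))
  rw [Polynomial.monomial_pow, one_mul, add_comm]

variable [IsNoetherianRing R]

/-- If every associated prime of `A / 𝔞` containing `t` contains `T`, then some power of `T` kills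
the kernel of multiplication by `t` on `A / 𝔞`. -/
theorem exists_pow_mul_mem_of_forall_associatedPrimes {A : Type*} [CommRing A]
    [IsNoetherianRing A] (𝔞 T : Ideal A) (t : A)
    (h : ∀ Q ∈ associatedPrimes A (A ⧸ 𝔞), t ∈ Q → T ≤ Q) :
    ∃ c, ∀ a ∈ T ^ c, ∀ z, t * z ∈ 𝔞 → a * z ∈ 𝔞 := by
  let K : Submodule A (A ⧸ 𝔞) := LinearMap.ker (LinearMap.lsmul A (A ⧸ 𝔞) t)
  -- The minimal primes of Ann K are associated to K, hence to A/𝔞, and contain t because t kills K.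
  have hrad : T ≤ (Module.annihilator A K).radical := by
    rw [← Ideal.sInf_minimalPrimes]
    refine le_sInf fun Q hQ => ?_
    have hQK := Module.associatedPrimes.minimalPrimes_annihilator_subset_associatedPrimes A K hQ
    have hQG := associatedPrimes.subset_of_injective (f := K.subtype) K.injective_subtype hQK
    refine h Q hQG (hQ.1.2 ?_)
    rw [Module.mem_annihilator]
    rintro ⟨z, hz⟩
    exact Subtype.ext hz
  obtain ⟨c, hc⟩ := Ideal.exists_pow_le_of_le_radical_of_fg hrad (IsNoetherian.noetherian _)
  refine ⟨c, fun a ha z htz => ?_⟩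
  have hz : Submodule.mkQ 𝔞 z ∈ K := by
    rw [LinearMap.mem_ker, LinearMap.lsmul_apply, ← map_smul, Submodule.mkQ_apply,
      Submodule.Quotient.mk_eq_zero, smul_eq_mul]
    exact htz
  have h1 := congrArg Subtype.val (Module.mem_annihilator.mp (hc ha) ⟨_, hz⟩)
  change a • Submodule.mkQ 𝔞 z = 0 at h1
  rwa [← map_smul, Submodule.mkQ_apply, Submodule.Quotient.mk_eq_zero, smul_eq_mul] at h1

/-- In the associated graded ring, if the degree-one form of y avoids all associated primes except
those containing the irrelevant ideal, then a power of that ideal kills the annihilator of the form.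
-/
theorem exists_pow_mul_mem_of_notMem_associatedPrimes {J : Ideal R} (y : J)
    (hy : ∀ Q ∈ associatedPrimes (reesAlgebra J) (reesAlgebra J ⧸ reesShiftIdeal J),
      reesLinear J y ∈ Q → ∀ a, reesLinear J a ∈ Q) :
    ∃ c, ∀ n, ∀ u ∈ J ^ n, y.1 * u ∈ J ^ (n + 2) → ∀ a ∈ J ^ c, a * u ∈ J ^ (c + n + 1) := by
  obtain ⟨c, hc⟩ := exists_pow_mul_mem_of_forall_associatedPrimes (reesShiftIdeal J)
    (Ideal.span (Set.range (reesLinear J))) (reesLinear J y) (fun Q hQ h => by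
      rw [Ideal.span_le]
      rintro _ ⟨a, rfl⟩
      exact hy Q hQ h a)
  refine ⟨c, fun n u hu hyu a ha => ?_⟩
  have h1 := hc _ (reesMonomial_mem_span_range_pow c ha) (reesMonomial n u hu) (by
    have hy1 : y.1 ∈ J ^ 1 := by rw [pow_one]; exact y.2
    have : reesLinear J y * reesMonomial n u hu = _ := reesMonomial_mul hy1 hu
    rw [this, reesMonomial_mem_reesShiftIdeal]
    rwa [show 1 + n + 1 = n + 2 by ring])
  rwa [reesMonomial_mul, reesMonomial_mem_reesShiftIdeal] at h1

/-- The elements u of Jⁿ with yu ∈ Jⁿ⁺² form a filtration that is stable by Artin–Rees. For large n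
its n-th term is therefore Jᶜ times an earlier term, up to further powers of J, and Jᶜ raises the
order by one more than expected. -/
theorem exists_forall_mem_pow_succ_of_pow_mul_mem {J : Ideal R} {y : R} {c : ℕ}
    (h : ∀ n, ∀ u ∈ J ^ n, y * u ∈ J ^ (n + 2) → ∀ a ∈ J ^ c, a * u ∈ J ^ (c + n + 1)) :
    ∃ n₀, ∀ n ≥ n₀, ∀ u ∈ J ^ n, y * u ∈ J ^ (n + 2) → u ∈ J ^ (n + 1) := by
  let F : J.Filtration R :=
    { N := fun n => J ^ n ⊓ Submodule.comap (LinearMap.mulLeft R y) (J ^ (n + 2))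
      mono := fun n u hu => ⟨Ideal.pow_le_pow_right n.le_succ hu.1,
        Ideal.pow_le_pow_right (show n + 2 ≤ n + 1 + 2 by omega) hu.2⟩
      smul_le := fun n => Submodule.smul_le.mpr fun r hr u hu => by
        refine ⟨?_, ?_⟩
        · rw [pow_succ', smul_eq_mul]
          exact Ideal.mul_mem_mul hr hu.1
        · change y * (r * u) ∈ J ^ (n + 1 + 2)
          rw [mul_left_comm, show n + 1 + 2 = n + 2 + 1 by ring, pow_succ' J (n + 2)]
          exact Ideal.mul_mem_mul hr hu.2 }
  have hstable : F.Stable := (Ideal.stableFiltration_stable J (⊤ : Ideal R)).of_le (fun n u hu => by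
    change u ∈ J ^ n • (⊤ : Ideal R)
    rw [smul_eq_mul, Ideal.mul_top]
    exact hu.1)
  obtain ⟨n₀, hn₀⟩ := hstable.exists_pow_smul_eq
  refine ⟨n₀ + c, fun n hn u hu hyu => ?_⟩
  obtain ⟨k, rfl⟩ := Nat.exists_eq_add_of_le hn
  have hmem : u ∈ F.N (n₀ + (k + c)) := by
    rw [show n₀ + (k + c) = n₀ + c + k by ring]
    exact ⟨hu, hyu⟩
  rw [hn₀, pow_add, Submodule.mul_smul] at hmem
  have hle : J ^ c • F.N n₀ ≤ J ^ (c + n₀ + 1) := Submodule.smul_le.mpr fun a ha v hv =>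
    h n₀ v hv.1 hv.2 a ha
  have := Submodule.smul_mono (le_refl (J ^ k)) hle hmem
  rw [smul_eq_mul, ← pow_add] at this
  convert this using 2
  ring

/-- For a superficial element `y`, the intersection of `yR` with `Jⁿ⁺¹` is `y Jⁿ` for large `n`. -/
theorem exists_forall_mem_span_singleton_mul_pow {J : Ideal R} {y : R} {n₀ : ℕ}
    (h : ∀ n ≥ n₀, ∀ u ∈ J ^ n, y * u ∈ J ^ (n + 2) → u ∈ J ^ (n + 1)) :
    ∃ N, ∀ n ≥ N, ∀ x ∈ J ^ (n + 1), x ∈ Ideal.span {y} → x ∈ Ideal.span {y} * J ^ n := by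
  obtain ⟨k, hk⟩ := J.exists_pow_inf_eq_pow_smul (Ideal.span {y})
  refine ⟨n₀ + k, fun n hn x hx hxy => ?_⟩
  have h1 : x ∈ J ^ (n + 1 - k) • (J ^ k • ⊤ ⊓ Ideal.span {y} : Ideal R) := by
    rw [← hk (n + 1) (by omega)]
    refine ⟨?_, hxy⟩
    rw [smul_eq_mul, Ideal.mul_top]
    exact hx
  have h2 : x ∈ J ^ (n + 1 - k) * Ideal.span {y} := Submodule.smul_mono le_rfl inf_le_right h1
  obtain ⟨w, hw, rfl⟩ := Ideal.mem_mul_span_singleton.mp h2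
  -- Artin–Rees only gives w ∈ Jⁿ⁺¹⁻ᵏ; since this is inside J^n₀, the hypothesis `h` can raise the
  -- order one step at a time up to n.
  have key : ∀ j, n₀ + j ≤ n → w ∈ J ^ (n₀ + j) := by
    intro j
    induction j with
    | zero => exact fun _ => Ideal.pow_le_pow_right (by omega) hw
    | succ j ih =>
      intro hj
      refine h (n₀ + j) (by omega) w (ih (by omega)) ?_
      rw [mul_comm]
      exact Ideal.pow_le_pow_right (by omega) hx
  obtain ⟨j, rfl⟩ := Nat.exists_eq_add_of_le (show n₀ ≤ n by omega)
  rw [mul_comm w]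
  exact Ideal.mul_mem_mul (Ideal.mem_span_singleton_self y) (key j le_rfl)

end Reductions

/-! ### Generators and existence of minimal reductions -/

section MinimalReductions

theorem finite_associatedPrimes_quotient {A : Type*} [CommRing A] [IsNoetherianRing A]
    (𝔞 : Ideal A) : (associatedPrimes A (A ⧸ 𝔞)).Finite :=
  associatedPrimes.finite A _

/-- Every reduction of the maximal ideal contains a superficial element that lies in no minimal
prime, if the residue field is infinite and the dimension is positive. -/
theorem exists_superficial {R : Type*} [CommRing R] [IsLocalRing R] [IsNoetherianRing R]
    [Infinite (ResidueField R)] {I : Ideal R} (hI : IsIdealReduction I (maximalIdeal R))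
    (hdim : ringKrullDim R ≠ 0) :
    ∃ y ∈ I, (∀ p ∈ minimalPrimes R, y ∉ p) ∧ ∃ N, ∀ n ≥ N, ∀ x ∈ maximalIdeal R ^ (n + 1),
      x ∈ Ideal.span {y} → x ∈ Ideal.span {y} * maximalIdeal R ^ n := by
  let τ : I →ₗ[R] reesAlgebra (maximalIdeal R) := (reesLinear (maximalIdeal R)).comp (Submodule.inclusion hI.1)
  let bad : Set (Ideal (reesAlgebra (maximalIdeal R))) := {Q ∈ associatedPrimes
    (reesAlgebra (maximalIdeal R)) (_ ⧸ reesShiftIdeal (maximalIdeal R)) |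
    ¬ ∀ a, reesLinear (maximalIdeal R) a ∈ Q}
  -- The first family consists of preimages of the associated primes of the graded ring that miss
  -- some degree-one form; the second, of the minimal primes of R. None is all of I, because I is a
  -- reduction and dim R > 0.
  let s : Set (Submodule R I) := (fun Q => (Q.restrictScalars R).comap τ) '' bad ∪
    (fun p => Submodule.comap I.subtype p) '' minimalPrimes R
  have hbad : bad.Finite := (finite_associatedPrimes_quotient
    (reesShiftIdeal (maximalIdeal R))).subset (Set.sep_subset _ _)
  have hs : s.Finite := (hbad.image _).union
    ((minimalPrimes.finite_of_isNoetherianRing R).image _)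
  have htop : ⊤ ∉ s := by
    rintro (⟨Q, ⟨hQ, hbad⟩, hQtop⟩ | ⟨p, hp, hptop⟩)
    · refine hbad (reesLinear_mem_of_isIdealReduction hI (IsAssociatedPrime.isPrime hQ)
        fun a ha => ?_)
      have : (⟨a, ha⟩ : I) ∈ (Q.restrictScalars R).comap τ := by
        beta_reduce at hQtop
        rw [hQtop]
        trivial
      exact this
    · have hIp : I ≤ p := fun a ha => by
        have : (⟨a, ha⟩ : I) ∈ Submodule.comap I.subtype p := by
          beta_reduce at hptop
          rw [hptop]
          trivial
        exact this
      have hprime := Ideal.IsMinimalPrime.isPrime hp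
      obtain ⟨-, c, hc⟩ := hI
      have hmp : maximalIdeal R ≤ p := hprime.le_of_pow_le (n := c + 1)
        (hc ▸ Ideal.mul_le_left.trans hIp)
      have := (le_maximalIdeal hprime.ne_top).antisymm hmp
      subst this
      refine hdim ?_
      rw [← maximalIdeal_height_eq_ringKrullDim, Ideal.height_eq_zero_iff.mpr hp]
      rfl
  obtain ⟨⟨y, hyI⟩, hy⟩ := exists_forall_notMem_of_infinite_residueField hs htop
  obtain ⟨c, hc⟩ := exists_pow_mul_mem_of_notMem_associatedPrimes (⟨y, hI.1 hyI⟩ : maximalIdeal R)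
    (fun Q hQ hyQ => by
      by_contra hcon
      exact hy _ (Or.inl ⟨Q, ⟨hQ, hcon⟩, rfl⟩) hyQ)
  obtain ⟨n₀, hn₀⟩ := exists_forall_mem_pow_succ_of_pow_mul_mem hc
  exact ⟨y, hyI, fun p hp hyp => hy _ (Or.inr ⟨p, hp, rfl⟩) hyp,
    exists_forall_mem_span_singleton_mul_pow hn₀⟩

theorem exists_pow_maximalIdeal_eq_bot {R : Type*} [CommRing R] [IsLocalRing R]
    [IsNoetherianRing R] (h : ringKrullDim R ≤ 0) : ∃ t, maximalIdeal R ^ t = ⊥ := by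
  have : Ring.KrullDimLE 0 R := ⟨h⟩
  obtain ⟨t, ht⟩ := Ideal.exists_pow_le_of_le_radical_of_fg (I := maximalIdeal R) (J := ⊥)
    (Ring.KrullDimLE.nilradical_eq_maximalIdeal (R := R)).ge (IsNoetherian.noetherian _)
  exact ⟨t, le_bot_iff.mp ht⟩

/-- Over an infinite residue field, every reduction of the maximal ideal contains a reduction
generated by `dim R` elements. -/
theorem exists_ofList_isIdealReduction (d : ℕ) : ∀ (R : Type u) [CommRing R] [IsLocalRing R]
    [IsNoetherianRing R] [Infinite (ResidueField R)] (I : Ideal R),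
    IsIdealReduction I (maximalIdeal R) → ringKrullDim R ≤ d → ∃ ys : List R, ys.length = d ∧
      (∀ y ∈ ys, y ∈ I) ∧ IsIdealReduction (Ideal.ofList ys) (maximalIdeal R) := by
  induction d with
  | zero =>
    intro R _ _ _ _ I _ hdim
    obtain ⟨t, ht⟩ := exists_pow_maximalIdeal_eq_bot (by simpa using hdim)
    exact ⟨[], rfl, by simp, by simp, t, by rw [pow_succ, ht]; simp⟩
  | succ d ih =>
    intro R _ _ _ _ I hI hdim
    by_cases hd : ringKrullDim R ≤ d
    · obtain ⟨ys, h1, h2, h3⟩ := ih R I hI hd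
      -- Padding with 0 gives exactly d + 1 generators.
      exact ⟨0 :: ys, by simp [h1], by simpa using h2, by simpa using h3⟩
    have hd0 : ringKrullDim R ≠ 0 := fun h0 => hd (by rw [h0]; exact_mod_cast d.zero_le)
    obtain ⟨y, hyI, hymin, N, hN⟩ := exists_superficial hI hd0
    have hym := hI.1 hyI
    have hnt : Nontrivial (R ⧸ Ideal.span {y}) := Ideal.Quotient.nontrivial_iff.mpr
      (fun h => (maximalIdeal.isMaximal R).ne_top (top_le_iff.mp
        (h ▸ (Ideal.span_singleton_le_iff_mem _).mpr hym)))
    have hloc : IsLocalRing (R ⧸ Ideal.span {y}) :=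
      .of_surjective' (Ideal.Quotient.mk _) Ideal.Quotient.mk_surjective
    have hmap : (maximalIdeal R).map (Ideal.Quotient.mk (Ideal.span {y})) = maximalIdeal _ :=
      map_maximalIdeal_of_surjective _ Ideal.Quotient.mk_surjective
    have hlh : IsLocalHom (Ideal.Quotient.mk (Ideal.span {y})) :=
      .of_surjective _ Ideal.Quotient.mk_surjective
    have hinf : Infinite (ResidueField (R ⧸ Ideal.span {y})) :=
      Infinite.of_injective _ (ResidueField.map (Ideal.Quotient.mk (Ideal.span {y}))).injective
    have hdim' : ringKrullDim (R ⧸ Ideal.span {y}) ≤ d := by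
      have h1 := Module.supportDim_quotSMulTop_succ_eq_of_notMem_minimalPrimes_of_mem_maximalIdeal
        (M := R) (x := y) (by
          rw [Module.annihilator_eq_bot.mpr inferInstance]
          exact hymin) hym
      rw [Module.supportDim_self_eq_ringKrullDim] at h1
      have h2 : Module.supportDim R (QuotSMulTop y R) = ringKrullDim (R ⧸ Ideal.span {y}) := by
        rw [← Module.supportDim_quotient_eq_ringKrullDim]
        exact Module.supportDim_eq_of_equiv (Submodule.quotEquivOfEq _ _ (by
          rw [← Submodule.ideal_span_singleton_smul]; simp))
      rw [h2] at h1
      obtain ⟨e, he⟩ := exists_natCast_eq_ringKrullDim (R ⧸ Ideal.span {y})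
      rw [← h1, he] at hdim
      rw [he]
      norm_cast at hdim ⊢
      omega
    obtain ⟨zs, hz1, hz2, hz3⟩ := ih (R ⧸ Ideal.span {y}) (I.map (Ideal.Quotient.mk _))
      ⟨hmap ▸ Ideal.map_mono hI.1, by
        obtain ⟨-, c, hc⟩ := hI
        exact ⟨c, by rw [← hmap, ← Ideal.map_pow, ← Ideal.map_pow, ← Ideal.map_mul, hc]⟩⟩ hdim'
    have hlift : ∀ z : R ⧸ Ideal.span {y}, ∃ a : R, Ideal.Quotient.mk _ a = z ∧
        (z ∈ I.map (Ideal.Quotient.mk (Ideal.span {y})) → a ∈ I) := by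
      intro z
      by_cases hz : z ∈ I.map (Ideal.Quotient.mk (Ideal.span {y}))
      · obtain ⟨a, ha, rfl⟩ :=
          (Ideal.mem_map_iff_of_surjective _ Ideal.Quotient.mk_surjective).mp hz
        exact ⟨a, rfl, fun _ => ha⟩
      · obtain ⟨a, rfl⟩ := Ideal.Quotient.mk_surjective z
        exact ⟨a, rfl, fun h => absurd h hz⟩
    choose g hg hgI using hlift
    have hgs : ∀ a ∈ zs.map g, a ∈ I := by
      intro a ha
      obtain ⟨z, hz, rfl⟩ := List.mem_map.mp ha
      exact hgI z (hz2 z hz)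
    have hmapg : (Ideal.ofList (zs.map g)).map (Ideal.Quotient.mk (Ideal.span {y})) =
        Ideal.ofList zs := by
      rw [Ideal.map_ofList, List.map_map]
      congr 1
      conv_rhs => rw [← List.map_id zs]
      exact List.map_congr_left fun a _ => hg a
    have hys : ∀ a ∈ y :: zs.map g, a ∈ I := by simpa using ⟨hyI, by simpa using hgs⟩
    have hysm : Ideal.ofList (y :: zs.map g) ≤ maximalIdeal R :=
      (Ideal.span_le.mpr fun a ha => hys a ha).trans hI.1
    refine ⟨y :: zs.map g, by simp [hz1], hys, hysm, ?_⟩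
    obtain ⟨n₀, hn₀⟩ := hz3.eventually
    refine ⟨max N n₀, le_antisymm ?_ fun x hx => ?_⟩
    · rw [pow_succ']
      exact Ideal.mul_mono_left hysm
    · set n := max N n₀
      have h1 : Ideal.Quotient.mk (Ideal.span {y}) x ∈
          (Ideal.ofList (zs.map g) * maximalIdeal R ^ n).map (Ideal.Quotient.mk _) := by
        rw [Ideal.map_mul, Ideal.map_pow, hmapg, hmap, hn₀ n (le_max_right _ _), ← hmap,
          ← Ideal.map_pow]
        exact Ideal.mem_map_of_mem _ hx
      obtain ⟨z, hz, hzx⟩ := (Ideal.mem_map_iff_of_surjective _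
        Ideal.Quotient.mk_surjective).mp h1
      have hzm : z ∈ maximalIdeal R ^ (n + 1) := by
        rw [pow_succ']
        refine Ideal.mul_mono_left (le_trans ?_ hysm) hz
        rw [Ideal.ofList_cons]
        exact le_sup_right
      -- The difference x − z lies in (y) ∩ 𝔪ⁿ⁺¹, hence in y𝔪ⁿ since y is superficial. This is how
      -- the reduction lifts from R/(y).
      have h2 := hN n (le_max_left _ _) (x - z) (sub_mem hx hzm)
        (Ideal.Quotient.eq.mp hzx.symm)
      rw [Ideal.ofList_cons, Ideal.sup_mul]
      exact Submodule.mem_sup.mpr ⟨_, h2, z, hz, sub_add_cancel _ _⟩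

theorem IsMinimalReduction.exists_ofList {R : Type*} [CommRing R] [IsLocalRing R]
    [IsNoetherianRing R] [Infinite (ResidueField R)] {I : Ideal R}
    (h : IsMinimalReduction I (maximalIdeal R)) :
    ∃ ys : List R, (ys.length : WithBot ℕ∞) = ringKrullDim R ∧ I = Ideal.ofList ys := by
  obtain ⟨d, hd⟩ := exists_natCast_eq_ringKrullDim R
  obtain ⟨ys, h1, h2, h3⟩ := exists_ofList_isIdealReduction d R I h.prop hd.le
  have hle : Ideal.ofList ys ≤ I := Ideal.span_le.mpr fun y hy => h2 y hy
  exact ⟨ys, by rw [h1, hd], (h.le_of_le h3 hle).antisymm hle⟩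

/-- A proper subideal `J < I` of a finitely generated ideal is generated modulo `𝔪I` by fewer
elements than `I`. -/
theorem exists_le_spanFinrank_lt {R : Type*} [CommRing R] [IsLocalRing R] [IsNoetherianRing R]
    {I J : Ideal R} (hJI : J < I) :
    ∃ Z ≤ J, Z.spanFinrank < I.spanFinrank ∧ J ≤ Z ⊔ maximalIdeal R * I := by
  let T : Submodule R I := maximalIdeal R • ⊤
  let J' : Submodule R I := Submodule.comap I.subtype J
  let W : Submodule R (I ⧸ T) := J'.map T.mkQ
  have hTfin : Module.length R (I ⧸ T) ≠ ⊤ :=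
    length_quotient_ne_top (t := 1) (pow_one (maximalIdeal R)).le
  have hfl := isFiniteLength_iff_isNoetherian_isArtinian.mp (Module.length_ne_top_iff.mp hTfin)
  have := hfl.2
  have hW : W ≠ ⊤ := by
    intro hW
    have h1 : (⊤ : Submodule R I) ≤ J' ⊔ maximalIdeal R • ⊤ := by
      rw [← Submodule.comap_map_mkQ T J' |>.trans (sup_comm _ _)]
      change ⊤ ≤ W.comap T.mkQ
      rw [hW, Submodule.comap_top]
    have h2 := Submodule.le_of_le_smul_of_le_jacobson_bot (IsNoetherian.noetherian _)
      (maximalIdeal_le_jacobson _) h1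
    exact hJI.not_ge fun a ha => h2 (x := ⟨a, ha⟩) trivial
  -- Here ν(W) = ℓ(W/𝔪W) ≤ ℓ(W) < ℓ(I/𝔪I) = ν(I).
  have hlt : (⊤ : Submodule R W).spanFinrank < I.spanFinrank := by
    rw [← Nat.cast_lt (α := ℕ∞), ← Submodule.spanFinrank_top I, spanFinrank_top_eq_length,
      spanFinrank_top_eq_length]
    exact (Module.length_le_of_surjective _ (Submodule.mkQ_surjective _)).trans_lt
      (Submodule.length_lt hW)
  rw [Submodule.spanFinrank_top] at hlt
  obtain ⟨s, hcard, hspan⟩ := Submodule.FG.exists_span_finset_card_eq_spanFinrank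
    (IsNoetherian.noetherian W)
  have hlift : ∀ w : I ⧸ T, ∃ a : I, T.mkQ a = w ∧ (w ∈ W → a.1 ∈ J) := by
    intro w
    by_cases hw : w ∈ W
    · obtain ⟨a, ha, rfl⟩ := hw
      exact ⟨a, rfl, fun _ => ha⟩
    · obtain ⟨a, rfl⟩ := T.mkQ_surjective w
      exact ⟨a, rfl, fun h => absurd h hw⟩
  choose g hg hgJ using hlift
  let Z' : Submodule R I := Submodule.span R (g '' s)
  have hZ' : Z'.map T.mkQ = W := by
    rw [Submodule.map_span, ← Set.image_comp, ← hspan]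
    congr 1
    convert Set.image_id _
    exact funext hg
  have hmap : Z'.map I.subtype = Ideal.span ((fun w => (g w).1) '' s) := by
    rw [Submodule.map_span, ← Set.image_comp]
    rfl
  refine ⟨Z'.map I.subtype, ?_, ?_, ?_⟩
  · rw [hmap, Ideal.span_le]
    rintro _ ⟨w, hw, rfl⟩
    exact hgJ w (hspan ▸ Submodule.subset_span hw)
  · rw [hmap]
    refine lt_of_le_of_lt (Submodule.spanFinrank_span_le_ncard_of_finite
      (s.finite_toSet.image _)) (lt_of_le_of_lt (Set.ncard_image_le s.finite_toSet) ?_)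
    rwa [Set.ncard_coe_finset, hcard]
  · intro a ha
    have h1 : T.mkQ ⟨a, hJI.le ha⟩ ∈ Z'.map T.mkQ := by
      rw [hZ']
      exact ⟨⟨a, hJI.le ha⟩, ha, rfl⟩
    obtain ⟨z, hz, hza⟩ := h1
    have h2 : (⟨a, hJI.le ha⟩ : I) - z ∈ T := (Submodule.Quotient.eq T).mp hza.symm
    have h3 : (I.subtype (⟨a, hJI.le ha⟩ - z)) ∈ maximalIdeal R * I := by
      have := Submodule.mem_map_of_mem (f := I.subtype) h2
      rwa [Submodule.map_smul'', Submodule.map_top, Submodule.range_subtype] at this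
    exact Submodule.mem_sup.mpr ⟨z, ⟨z, hz, rfl⟩, _, h3, by simp⟩

/-- A reduction I with the fewest generators is minimal. A smaller reduction J would contain some Z
with fewer generators and J ⊆ Z + 𝔪I; then 𝔪ᶜ⁺¹ = J𝔪ᶜ ⊆ Z𝔪ᶜ + 𝔪·𝔪ᶜ⁺¹, and Nakayama makes Z a
reduction. -/
theorem exists_isMinimalReduction (R : Type*) [CommRing R] [IsLocalRing R]
    [IsNoetherianRing R] : ∃ I : Ideal R, IsMinimalReduction I (maximalIdeal R) := by
  classical
  have hex : ∃ r : ℕ, ∃ I : Ideal R, IsIdealReduction I (maximalIdeal R) ∧ I.spanFinrank = r :=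
    ⟨_, maximalIdeal R, ⟨le_rfl, 0, by simp⟩, rfl⟩
  obtain ⟨I, hI, hr⟩ := Nat.find_spec hex
  refine ⟨I, hI, fun J hJ hJI => ?_⟩
  by_contra hcon
  obtain ⟨Z, hZJ, hZr, hJZ⟩ := exists_le_spanFinrank_lt (lt_of_le_not_ge hJI hcon)
  refine Nat.find_min hex (hr ▸ hZr) ⟨Z, ⟨hZJ.trans hJ.1, ?_⟩, rfl⟩
  obtain ⟨-, c, hc⟩ := hJ
  refine ⟨c, le_antisymm ?_ ?_⟩
  · rw [pow_succ']
    exact Ideal.mul_mono_left (hZJ.trans (hJI.trans hI.1))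
  · refine Submodule.le_of_le_smul_of_le_jacobson_bot (IsNoetherian.noetherian _)
      (maximalIdeal_le_jacobson _) ?_
    conv_lhs => rw [← hc]
    refine (Ideal.mul_mono_left hJZ).trans ?_
    rw [Ideal.sup_mul, mul_assoc, smul_eq_mul, pow_succ' _ c]
    gcongr
    exact hI.1

end MinimalReductions

theorem eq_of_length_quotient_eq {R M : Type*} [Ring R] [AddCommGroup M] [Module R M]
    {p q : Submodule R M} (hpq : p ≤ q)
    (hfin : Module.length R (M ⧸ p) ≠ ⊤)
    (h : Module.length R (M ⧸ p) = Module.length R (M ⧸ q)) : p = q := by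
  let f := Submodule.factor hpq
  have h1 := Module.length_eq_add_of_exact (LinearMap.ker f).subtype f
    (Submodule.injective_subtype _) (Submodule.factor_surjective hpq)
    (LinearMap.exact_subtype_ker_map f)
  rw [← h] at h1
  have h2 : Module.length R (LinearMap.ker f) = 0 :=
    ENat.add_left_injective_of_ne_top hfin (h1.symm.trans (zero_add _).symm)
  rw [Module.length_eq_zero_iff] at h2
  refine le_antisymm hpq fun u hu => ?_
  have hu' : Submodule.mkQ p u ∈ LinearMap.ker f := by
    rw [LinearMap.mem_ker]
    exact (Submodule.Quotient.mk_eq_zero q).mpr hu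
  have := congrArg Subtype.val (Subsingleton.elim (⟨_, hu'⟩ : LinearMap.ker f) 0)
  exact (Submodule.Quotient.mk_eq_zero p).mp this

/-! ### Maximal Cohen–Macaulay modules over a local domain -/

section MaximalCohenMacaulay

theorem ringKrullDim_quotient_add_one_le_ringKrullDim {R : Type*} [CommRing R] [IsDomain R]
    {P : Ideal R} {r : R} (hr : r ≠ 0)
    (hrP : r ∈ P) : ringKrullDim (R ⧸ P) + 1 ≤ ringKrullDim R :=
  ringKrullDim_succ_le_of_surjective (Ideal.Quotient.mk P) Ideal.Quotient.mk_surjective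
    (mem_nonZeroDivisors_of_ne_zero hr) (Ideal.Quotient.eq_zero_iff_mem.mpr hrP)

variable {R : Type*} [CommRing R] [IsLocalRing R] {M : Type*} [AddCommGroup M] [Module R M]

/-- Even 0 is regular on the zero module. The resulting infinite depth rules out zero MCM modules.
-/
theorem hasDepthAtLeast_of_subsingleton [Subsingleton M] (n : ℕ) : HasDepthAtLeast R M n := by
  induction n generalizing M with
  | zero => exact hasDepthAtLeast_zero
  | succ n ih =>
    refine hasDepthAtLeast_succ_iff.mpr ⟨0, zero_mem _, fun a b _ => Subsingleton.elim a b, ?_⟩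
    have : Subsingleton (QuotSMulTop (0 : R) M) := (Submodule.mkQ_surjective _).subsingleton
    exact ih

theorem IsMCM.hasDepthAtLeast (h : IsMCM R M) {d : ℕ} (hd : ringKrullDim R = d) :
    HasDepthAtLeast R M d := by
  refine natCast_le_localDepth_iff.mp (le_of_eq ?_)
  have h1 := h.depth_eq
  rw [hd] at h1
  exact_mod_cast h1.symm

variable [IsNoetherianRing R]

theorem IsMCM.nontrivial (h : IsMCM R M) : Nontrivial M := by
  by_contra hcon
  rw [not_nontrivial_iff_subsingleton] at hcon
  obtain ⟨d, hd⟩ := exists_natCast_eq_ringKrullDim R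
  have h1 := h.depth_eq
  have h2 := natCast_le_localDepth_iff.mpr (hasDepthAtLeast_of_subsingleton (R := R) (M := M)
    (d + 1))
  rw [hd] at h1
  have h3 : localDepth R M = d := by exact_mod_cast h1
  rw [h3] at h2
  norm_cast at h2
  omega

theorem HasDepthAtLeast.isMCM [Nontrivial M] [Module.Finite R M] {d : ℕ}
    (h : HasDepthAtLeast R M d) (hd : ringKrullDim R = d) : IsMCM R M := by
  refine ⟨inferInstance, ?_⟩
  rw [hd]
  suffices localDepth R M = d by exact_mod_cast this
  refine le_antisymm ?_ (natCast_le_localDepth_iff.mpr h)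
  by_contra hlt
  have h1 : ((d + 1 : ℕ) : ℕ∞) ≤ localDepth R M := by
    push_cast
    exact Order.add_one_le_of_lt (not_le.mp hlt)
  have h2 := (natCast_le_localDepth_iff.mp h1).le_ringKrullDim
  rw [hd] at h2
  norm_cast at h2
  omega

variable [IsDomain R] [Module.Finite R M]

/-- An associated prime P containing r ≠ 0 would have dim R/P < dim R, below the depth of M. -/
theorem HasDepthAtLeast.isSMulRegular {d : ℕ} (h : HasDepthAtLeast R M d)
    (hd : ringKrullDim R = d) {r : R} (hr : r ≠ 0) : IsSMulRegular M r := by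
  by_contra hcon
  have : r ∈ ⋃ p ∈ associatedPrimes R M, (p : Set R) := by
    rwa [biUnion_associatedPrimes_eq_compl_regular R M]
  obtain ⟨P, hP, hrP⟩ := Set.mem_iUnion₂.mp this
  obtain ⟨e, he⟩ : ∃ e : ℕ, ringKrullDim (R ⧸ P) = e := by
    have := Ideal.Quotient.nontrivial_iff.mpr (IsAssociatedPrime.isPrime hP).ne_top
    have : IsLocalRing (R ⧸ P) := .of_surjective' (Ideal.Quotient.mk _)
      Ideal.Quotient.mk_surjective
    exact exists_natCast_eq_ringKrullDim _
  have h1 := h.le_ringKrullDim_quotient hP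
  have h2 := ringKrullDim_quotient_add_one_le_ringKrullDim hr hrP
  rw [he] at h1 h2
  rw [hd] at h2
  norm_cast at h1 h2
  omega

/-- An ideal of height at least two contains a regular element on `M / xM`, for `M` maximal
Cohen–Macaulay over a domain and `x ≠ 0` in the ideal. -/
theorem HasDepthAtLeast.exists_isSMulRegular_quotSMulTop {d : ℕ} (h : HasDepthAtLeast R M d)
    (hd : ringKrullDim R = d) {J : Ideal R} (hJ : 2 ≤ J.height) {x : R} (hxJ : x ∈ J)
    (hx : x ≠ 0) : ∃ y ∈ J, IsSMulRegular (QuotSMulTop x M) y := by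
  by_cases htop : J = ⊤
  · exact ⟨1, htop ▸ trivial, .one _⟩
  have hxm : x ∈ maximalIdeal R := le_maximalIdeal htop hxJ
  refine exists_mem_isSMulRegular_of_notMem_associatedPrimes J fun P hP hJP => ?_
  have hprime := IsAssociatedPrime.isPrime hP
  -- Height at least two gives a chain 0 ⊂ Q ⊂ P, so dim R/P ≤ d − 2. But P is associated to M/xM,
  -- of depth at least d − 1.
  have h2 : ¬ P.height ≤ (1 : ℕ) := fun hle => by
    have := hJ.trans ((Ideal.height_mono hJP).trans hle)
    norm_cast at this
  rw [Ideal.height_le_iff] at h2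
  push Not at h2
  obtain ⟨Q, hQ, hQP, hQ1⟩ := h2
  have hQ0 : Q ≠ ⊥ := by
    rintro rfl
    simp at hQ1
  obtain ⟨r, hrQ, hr0⟩ := Submodule.exists_mem_ne_zero_of_ne_bot hQ0
  obtain ⟨s, hsP, hsQ⟩ := SetLike.exists_of_lt hQP
  have e1 := ringKrullDim_quotient_add_one_le_ringKrullDim hr0 hrQ
  have e2 := ringKrullDim_quotient_add_one_le hQP.le hsP hsQ
  have hfin : ∀ I : Ideal R, I.IsPrime → ∃ e : ℕ, ringKrullDim (R ⧸ I) = e := fun I hI => by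
    have := Ideal.Quotient.nontrivial_iff.mpr hI.ne_top
    have : IsLocalRing (R ⧸ I) := .of_surjective' (Ideal.Quotient.mk _)
      Ideal.Quotient.mk_surjective
    exact exists_natCast_eq_ringKrullDim _
  obtain ⟨a, ha⟩ := hfin Q hQ
  obtain ⟨b, hb⟩ := hfin P hprime
  rw [ha, hd] at e1
  rw [ha, hb] at e2
  norm_cast at e1 e2
  obtain ⟨d, rfl⟩ : ∃ d', d = d' + 1 := ⟨d - 1, by omega⟩
  have e3 := (h.quotSMulTop hxm (h.isSMulRegular hd hx)).le_ringKrullDim_quotient hP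
  rw [hb] at e3
  norm_cast at e3
  omega

/-- Put xv = a and yv = b with a, b ∈ M. Then ya = xb, and regularity of y on M/xM gives a = xw;
cancelling x in V yields v = w. -/
theorem HasDepthAtLeast.mem_range_of_forall_smul_mem_range {d : ℕ} (h : HasDepthAtLeast R M d)
    (hd : ringKrullDim R = d) {V : Type*} [AddCommGroup V] [Module R V] {ι : M →ₗ[R] V}
    (hι : Function.Injective ι) (hV : ∀ r : R, r ≠ 0 → IsSMulRegular V r) {J : Ideal R}
    (hJ : 2 ≤ J.height) {v : V} (hv : ∀ r ∈ J, r • v ∈ LinearMap.range ι) :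
    v ∈ LinearMap.range ι := by
  have hJ0 : J ≠ ⊥ := by
    rintro rfl
    simp at hJ
  obtain ⟨x, hxJ, hx⟩ := Submodule.exists_mem_ne_zero_of_ne_bot hJ0
  obtain ⟨y, hyJ, hy⟩ := h.exists_isSMulRegular_quotSMulTop hd hJ hxJ hx
  obtain ⟨a, ha⟩ := hv x hxJ
  obtain ⟨b, hb⟩ := hv y hyJ
  obtain ⟨w, rfl⟩ := isSMulRegular_quotSMulTop_iff.mp hy a b (hι (by
    rw [map_smul, map_smul, ha, hb, smul_comm]))
  exact ⟨w, hV x hx (by simpa using ha)⟩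

theorem HasDepthAtLeast.supportDim_eq [Nontrivial M] {d : ℕ} (h : HasDepthAtLeast R M d)
    (hd : ringKrullDim R = d) : Module.supportDim R M = d := by
  have hann : Module.annihilator R M = ⊥ := by
    rw [eq_bot_iff]
    intro r hr
    by_contra hr0
    obtain ⟨m, hm⟩ := exists_ne (0 : M)
    exact hm ((h.isSMulRegular hd hr0).eq_zero_of_smul_eq_zero (Module.mem_annihilator.mp hr m))
  rw [Module.supportDim_eq_ringKrullDim_quotient_annihilator, hann,
    ringKrullDim_eq_of_ringEquiv (RingEquiv.quotientBot R), hd]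

/-- A maximal Cohen–Macaulay module `M` is Ulrich if and only if `IM = 𝔪M`, for a minimal
reduction `I` of `𝔪`. -/
theorem HasDepthAtLeast.isUlrich_iff [Nontrivial M] [Infinite (ResidueField R)] {d : ℕ}
    (h : HasDepthAtLeast R M d) (hd : ringKrullDim R = d) {I : Ideal R}
    (hI : IsMinimalReduction I (maximalIdeal R)) :
    IsUlrich R M ↔ (I • ⊤ : Submodule R M) = maximalIdeal R • ⊤ := by
  obtain ⟨ys, hlen, rfl⟩ := hI.exists_ofList
  have hred := hI.prop
  have hlen' : ys.length = d := by
    rw [hd] at hlen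
    exact_mod_cast hlen
  obtain ⟨hle, c, hc⟩ := hred
  have hpow : maximalIdeal R ^ (c + 1) ≤ Ideal.ofList ys := hc ▸ Ideal.mul_le_left
  have hreg : IsWeaklyRegular M ys := (hlen' ▸ h).isWeaklyRegular
    (fun y hy => hle (Ideal.subset_span hy)) (hpow.trans le_sup_left)
  have hmult := hasMultiplicity_of_isWeaklyRegular (M := M)
    (by rw [h.supportDim_eq hd, hlen']) hI.prop hreg
  have hfin : Module.length R (M ⧸ (Ideal.ofList ys • ⊤ : Submodule R M)) ≠ ⊤ :=
    length_quotient_ne_top hpow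
  have hν := spanFinrank_top_eq_length (R := R) (M := M)
  constructor
  -- Now ℓ(M/IM) = e(M) = ν(M) = ℓ(M/𝔪M) is finite, and IM ⊆ 𝔪M, so the submodules coincide.
  · intro hU
    have h1 := hU.multiplicity_eq.unique hmult
    refine eq_of_length_quotient_eq (Submodule.smul_mono_left hle) hfin ?_
    rw [← hν, ← ENat.natCast_toNat hfin]
    exact_mod_cast h1.symm
  · intro he
    refine ⟨h.isMCM hd, ?_⟩
    rw [he, ← hν, ENat.toNat_natCast] at hmult
    exact hmult

end MaximalCohenMacaulay

open scoped TensorProduct in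
/-- A maximal Cohen–Macaulay `R`-module is the restriction of scalars of a module over any ring
`R ⊆ S ⊆ K` such that `R :_R s` has height at least two for all `s ∈ S \ R`. -/
theorem HasDepthAtLeast.exists_linearEquiv_submodule {R : Type u} [CommRing R] [IsDomain R]
    [IsLocalRing R] [IsNoetherianRing R] {K : Type v} [Field K] [Algebra R K] [IsFractionRing R K]
    (S : Subalgebra R K)
    (hS : ∀ s ∈ S, s ∉ (algebraMap R K).range → 2 ≤ (denominatorIdeal R s).height)
    {M : Type w} [AddCommGroup M] [Module R M] [Module.Finite R M] {d : ℕ}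
    (h : HasDepthAtLeast R M d) (hd : ringKrullDim R = d) :
    ∃ N : Submodule S (K ⊗[R] M), Nonempty (M ≃ₗ[R] N) := by
  let ι : M →ₗ[R] K ⊗[R] M := TensorProduct.mk R K M 1
  have hι : Function.Injective ι := by
    intro a b hab
    obtain ⟨c, hc⟩ := (IsLocalizedModule.eq_iff_exists (nonZeroDivisors R) ι).mp hab
    exact h.isSMulRegular hd (nonZeroDivisors.coe_ne_zero c) hc
  have hV : ∀ r : R, r ≠ 0 → IsSMulRegular (K ⊗[R] M) r := fun r hr a b hab => by
    have hr' : algebraMap R K r ≠ 0 := by simpa using hr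
    have e : algebraMap R K r • a = algebraMap R K r • b := by
      simpa only [algebraMap_smul] using hab
    exact smul_right_injective _ hr' e
  let N : Submodule S (K ⊗[R] M) :=
    { carrier := LinearMap.range ι
      add_mem' := fun ha hb => add_mem ha hb
      zero_mem' := zero_mem _
      smul_mem' := by
        rintro ⟨s, hs⟩ v hv
        change s • v ∈ LinearMap.range ι
        have key : ∀ r r' : R, r • s = algebraMap R K r' → r • s • v ∈ LinearMap.range ι := by
          intro r r' e
          rw [← smul_assoc, e, algebraMap_smul]
          exact Submodule.smul_mem _ _ hv
        by_cases hsR : s ∈ (algebraMap R K).range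
        · obtain ⟨r, rfl⟩ := hsR
          simpa using key 1 r (one_smul _ _)
        · refine h.mem_range_of_forall_smul_mem_range hd hι hV (hS s hs hsR) fun r hr => ?_
          obtain ⟨r', hr'⟩ := Submodule.mem_one.mp (show r • s ∈ (1 : Submodule R K) from hr)
          exact key r r' hr'.symm }
  exact ⟨N, ⟨LinearEquiv.ofInjective ι hι⟩⟩

/-! ### Finite extensions by a regular local ring -/

section FiniteExtension

variable {R S : Type*} [CommRing R] [CommRing S] [IsLocalRing R] [Algebra R S]
  [Module.Finite R S]

/-- A prime of S containing 𝔪S contracts to 𝔪, so by integrality it is the maximal ideal of S. -/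
theorem exists_maximalIdeal_pow_le_map [IsLocalRing S] [IsNoetherianRing S] :
    ∃ t, maximalIdeal S ^ t ≤ (maximalIdeal R).map (algebraMap R S) := by
  refine Ideal.exists_pow_le_of_le_radical_of_fg ?_ (IsNoetherian.noetherian _)
  rw [Ideal.radical_eq_sInf]
  refine le_sInf fun Q ⟨hQ, hprime⟩ => ?_
  have hcomap : Q.comap (algebraMap R S) = maximalIdeal R :=
    (le_maximalIdeal (Ideal.comap_ne_top _ hprime.ne_top)).antisymm (Ideal.map_le_iff_le_comap.mp hQ)
  have hmax : (Q.comap (algebraMap R S)).IsMaximal := hcomap ▸ maximalIdeal.isMaximal R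
  exact (eq_maximalIdeal (Ideal.isMaximal_of_isIntegral_of_isMaximal_comap Q hmax)).ge

variable [IsNoetherianRing R] [Infinite (ResidueField R)]

theorem exists_ofList_map_algebraMap [IsLocalRing S] [IsNoetherianRing S] {d : ℕ}
    (hd : ringKrullDim R = d) : ∃ ys : List R, ys.length = d ∧ (∀ y ∈ ys, y ∈ maximalIdeal R) ∧
      ∃ t, maximalIdeal S ^ t ≤ Ideal.ofList (ys.map (algebraMap R S)) := by
  obtain ⟨ys, h1, h2, -, c, hc⟩ := exists_ofList_isIdealReduction d R (maximalIdeal R)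
    ⟨le_rfl, 0, by simp⟩ hd.le
  obtain ⟨t, ht⟩ := exists_maximalIdeal_pow_le_map (R := R) (S := S)
  refine ⟨ys, h1, h2, t * (c + 1), ?_⟩
  rw [pow_mul, ← Ideal.map_ofList]
  refine (Ideal.pow_right_mono ht _).trans ?_
  rw [← Ideal.map_pow, ← hc]
  exact Ideal.map_mono Ideal.mul_le_left

variable [FaithfulSMul R S] [IsRegularLocalRing S]

/-- A regular local ring that is finite over `R` has depth at least `dim R` as an `R`-module. -/
theorem IsRegularLocalRing.hasDepthAtLeast_of_finite {d : ℕ} (hd : ringKrullDim R = d) :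
    HasDepthAtLeast R S d := by
  obtain ⟨ys, h1, h2, t, ht⟩ := exists_ofList_map_algebraMap (S := S) hd
  obtain ⟨xs, hx1, -, hx3⟩ := IsRegularLocalRing.exists_ofList_eq_maximalIdeal S
  -- Integrality gives d = dim R ≤ dim S, so the depth of S suffices for the images of `ys`, which
  -- are parameters, to be S-regular.
  have hle : d ≤ xs.length := by
    have := ringKrullDim_le_of_isIntegral R S
    rw [hd, ← hx1] at this
    exact_mod_cast this
  refine ⟨ys, h1, h2, (isWeaklyRegular_map_algebraMap_iff S S ys).mp ?_⟩
  refine HasDepthAtLeast.isWeaklyRegular (hx3.of_le (by rw [List.length_map, h1]; exact hle))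
    (fun x hx => ?_) (ht.trans le_sup_left)
  obtain ⟨y, hy, rfl⟩ := List.mem_map.mp hx
  exact map_nonunit (algebraMap R S) y (h2 y hy)

/-- Over a regular local ring `S` finite over `R`, modules with `R`-depth at least `dim R` are
free. -/
theorem HasDepthAtLeast.free_of_isRegularLocalRing {N : Type*} [AddCommGroup N] [Module R N]
    [Module S N] [IsScalarTower R S N] [Module.Finite S N] {d : ℕ} (h : HasDepthAtLeast R N d)
    (hd : ringKrullDim R = d) : Module.Free S N := by
  obtain ⟨ys, h1, h2, t, ht⟩ := exists_ofList_map_algebraMap (S := S) hd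
  obtain ⟨xs, hx1, hx2, -⟩ := IsRegularLocalRing.exists_ofList_eq_maximalIdeal S
  -- The d images of `ys` generate an ideal containing a power of the maximal ideal of S, so dim S ≤
  -- d.
  have hle : xs.length ≤ d := by
    have h3 := ringKrullDim_quotient_le_length (I := (⊥ : Ideal S)) (t := t)
      (xs := ys.map (algebraMap R S)) (fun x hx => by
        obtain ⟨y, hy, rfl⟩ := List.mem_map.mp hx
        exact map_nonunit (algebraMap R S) y (h2 y hy)) (ht.trans le_sup_left)
    rw [ringKrullDim_eq_of_ringEquiv (RingEquiv.quotientBot S), ← hx1, List.length_map, h1] at h3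
    exact_mod_cast h3
  have hS : HasDepthAtLeast S N d := h.of_isLocalHom
  refine module_free_of_isWeaklyRegular _ S N xs rfl hx2 ((hS.of_le hle).isWeaklyRegular (t := 1)
    (fun x hx => hx2 ▸ Ideal.subset_span hx) ?_)
  rw [pow_one, hx2]
  exact le_sup_left

end FiniteExtension

/-! ### The structure theorem and the Ulrich criteria -/

theorem smul_top_eq_smul_top_iff_map_eq {R S : Type*} [CommRing R] [CommRing S] [Algebra R S]
    {I J : Ideal R} : (I • ⊤ : Submodule R S) = J • ⊤ ↔
      I.map (algebraMap R S) = J.map (algebraMap R S) := by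
  rw [Ideal.smul_top_eq_map, Ideal.smul_top_eq_map, Submodule.restrictScalars_inj]

theorem smul_top_eq_smul_top_of_surjective {R M N : Type*} [CommRing R] [AddCommGroup M]
    [Module R M] [AddCommGroup N] [Module R N] {I J : Ideal R} {f : M →ₗ[R] N}
    (hf : Function.Surjective f) (h : (I • ⊤ : Submodule R M) = J • ⊤) :
    (I • ⊤ : Submodule R N) = J • ⊤ := by
  have := congrArg (Submodule.map f) h
  rwa [Submodule.map_smul'', Submodule.map_smul'', Submodule.map_top,
    LinearMap.range_eq_top.mpr hf] at this

/-- Over a ring `R` with regular `S₂`-ification `S`, maximal Cohen–Macaulay modules are sums of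
copies of `S`. -/
theorem IsMCM.exists_linearEquiv_fin {R : Type u} [CommRing R] [IsDomain R] [IsLocalRing R]
    [IsNoetherianRing R] [Infinite (ResidueField R)] {K : Type v} [Field K] [Algebra R K]
    [IsFractionRing R K] {S : Subalgebra R K} (hS : IsS2ification R S) [IsRegularLocalRing S]
    {M : Type w} [AddCommGroup M] [Module R M] (hM : IsMCM R M) :
    ∃ h : ℕ, Nonempty (M ≃ₗ[R] (Fin h → S)) := by
  have := hS.finite
  have := hM.finite
  obtain ⟨d, hd⟩ := exists_natCast_eq_ringKrullDim R
  have hD := hM.hasDepthAtLeast hd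
  obtain ⟨N, ⟨e⟩⟩ := hD.exists_linearEquiv_submodule S hS.two_le_height hd
  have : Module.Finite R N := Module.Finite.equiv e
  have : Module.Finite S N := Module.Finite.of_restrictScalars_finite R S N
  have hN : HasDepthAtLeast R N d := hD.of_linearEquiv e
  have : Module.Free S N := HasDepthAtLeast.free_of_isRegularLocalRing (S := S) hN hd
  exact ⟨Module.finrank S N,
    ⟨e.trans ((Module.finBasis S N).equivFun.restrictScalars R)⟩⟩

theorem mainTheorem4 (R : Type u) [CommRing R] [IsDomain R] [IsLocalRing R]
    [IsNoetherianRing R] [Infinite (IsLocalRing.ResidueField R)]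
    (K : Type v) [Field K] [Algebra R K] [IsFractionRing R K]
    (S : Subalgebra R K) (hS : IsS2ification R S) [IsRegularLocalRing S] :
    (∀ (M : Type w) [AddCommGroup M] [Module R M], IsMCM R M →
      ∃ h : ℕ, Nonempty (M ≃ₗ[R] (Fin h → S))) ∧
    ((∃ (M : Type v) (_ : AddCommGroup M) (_ : Module R M), IsUlrich R M) ↔ IsUlrich R S) ∧
    (IsUlrich R S ↔ ∀ I : Ideal R, IsMinimalReduction I (IsLocalRing.maximalIdeal R) →
      I.map (algebraMap R S) = (IsLocalRing.maximalIdeal R).map (algebraMap R S)) ∧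
    (∀ I : Ideal R, IsMinimalReduction I (IsLocalRing.maximalIdeal R) →
      (IsUlrich R S ↔
        I.map (algebraMap R S) = (IsLocalRing.maximalIdeal R).map (algebraMap R S))) := by
  have := hS.finite
  obtain ⟨d, hd⟩ := exists_natCast_eq_ringKrullDim R
  have hdS : HasDepthAtLeast R S d := IsRegularLocalRing.hasDepthAtLeast_of_finite hd
  have key : ∀ I : Ideal R, IsMinimalReduction I (maximalIdeal R) →
      (IsUlrich R S ↔ I.map (algebraMap R S) = (maximalIdeal R).map (algebraMap R S)) :=
    fun I hI => (hdS.isUlrich_iff hd hI).trans smul_top_eq_smul_top_iff_map_eq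
  -- One minimal reduction must exist for the criterion over all of them not to be vacuous.
  obtain ⟨I, hI⟩ := exists_isMinimalReduction R
  refine ⟨fun M _ _ hM => hM.exists_linearEquiv_fin hS, ⟨?_, fun h => ⟨S, _, _, h⟩⟩,
    ⟨fun h J hJ => (key J hJ).mp h, fun h => (key I hI).mpr (h I hI)⟩, key⟩
  rintro ⟨M, _, _, hU⟩
  have := hU.isMCM.nontrivial
  have := hU.isMCM.finite
  obtain ⟨h, ⟨e⟩⟩ := hU.isMCM.exists_linearEquiv_fin hS
  have hh : 0 < h := by
    rw [Nat.pos_iff_ne_zero]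
    rintro rfl
    exact not_subsingleton M e.injective.subsingleton
  -- Projection to one factor of S^h carries IM = 𝔪M to IS = 𝔪S.
  let f : M →ₗ[R] S := LinearMap.proj (⟨0, hh⟩ : Fin h) ∘ₗ e.toLinearMap
  have hf : Function.Surjective f :=
    (Function.surjective_eval (⟨0, hh⟩ : Fin h)).comp e.surjective
  exact (hdS.isUlrich_iff hd hI).mpr (smul_top_eq_smul_top_of_surjective hf
    (((hU.isMCM.hasDepthAtLeast hd).isUlrich_iff hd hI).mp hU))
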